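/- **Setting.** All Hilbert spaces are complex and need not be separable; $\cong$ denotes unitary equivalence of bounded operators. For a nonzero Hilbert space $\mathcal M$, let $\ell^2_{\mathcal M}$ be the Hilbert space of square-summable sequences $(h_n)_{n\ge 0}$ in $\mathcal M$. An operator valued unilateral weighted shift with weights $W_n\in B(\mathcal M)$ $(n\ge 0)$ is a bounded operator $W$ on $\ell^2_{\mathcal M}$ with $W(h_0,h_1,\dots)=(0,W_0h_0,W_1h_1,\dots)$. For $n\ge 0$ let $$\xi_n(x)=\sqrt{\frac{1+(n+1)(x^2-1)}{1+n(x^2-1)}},\qquad x\in[1,\infty).$$ Let $E$ be a compactly supported $B(\mathcal M)$-valued Borel spectral measure on $[1,\infty)$, let $W_n=\int_{[1,\infty)}\xi_n\,dE$ for $n\ge 0$, and let $W$ be the operator valued unilateral weighted shift on $\ell^2_{\mathcal M}$ with weights $W_n$. Let $(\widetilde W,\widetilde{\mathcal M},(\widetilde W_n)_{n\ge0},\widetilde E)$ be another such system. **Spectral type and multiplicity.** Let $A$ be a bounded selfadjoint operator on a Hilbert space $\mathcal H$ with spectral measure $F$ on $\mathbb R$, and for $h\in\mathcal H$ put $\mu_h(\Delta)=\langle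 F(\Delta)h,h\rangle$. The *spectral type* of $A$ is the set of all finite Borel measures $\mu$ on $\mathbb R$ such that $\mu\ll\mu_h$ for some $h\in\mathcal H$. The *multiplicity function* of $A$ assigns to each finite Borel measure $\mu$ on $\mathbb R$ the supremum of the cardinalities of the sets $S\subseteq\mathcal H\setminus\{0\}$ such that $\mu_x=\mu$ for all $x\in S$ and $\langle x,F(\Delta)y\rangle=0$ for all distinct $x,y\in S$ and all Borel sets $\Delta$. If $\mathcal H$ is separable, a finite Borel measure $\mu$ and a measurable function $n:\mathbb R\to\{0,1,2,\dots,\infty\}$ are said to *represent the classical spectral type and multiplicity function* of $A$ if $\mu(\Delta)=0\Leftrightarrow F(\Delta)=0$ for all Borel $\Delta$ and there are $x_0,x_1,\dots\in\mathcal H$ such that $\mu_{x_k}$ is the restriction of $\mu$ to $\{n>k\}$ for every $k$, $\langle x_j,F(\Delta)x_k\rangle=0$ for all $j\ne k$ and all Borel $\Delta$, and the vectors $F(\Delta)x_k$ span a dense subspace (so $A$ is multiplication by $t$ on a direct integral $\int^{\oplus}\mathcal H(t)\,d\mu(t)$ with $\dim\mathcal H(t)=n(t)$). **Theorem.** The following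 conditions are equivalent: 1. $W\cong\widetilde W$; 2. $W_0\cong\widetilde W_0$; 3. the spectral types of $W_0$ and $\widetilde W_0$ coincide, and so do their multiplicity functions; 4. $E$ and $\widetilde E$ are unitarily equivalent, i.e. there is a unitary isomorphism $U:\mathcal M\to\widetilde{\mathcal M}$ with $UE(\Delta)=\widetilde E(\Delta)U$ for all Borel $\Delta$. If $\mathcal M$ and $\widetilde{\mathcal M}$ are separable, then the classical spectral types and multiplicity functions of $W_0$ and $\widetilde W_0$ have representatives, and whenever $(\mu,n)$ represents those of $W_0$ and $(\tilde\mu,\tilde n)$ those of $\widetilde W_0$, condition 2 holds if and only if $\mu$ and $\tilde\mu$ are mutually absolutely continuous and $n=\tilde n$ $\mu$-almost everywhere. Moreover, if $W_0$ and $\widetilde W_0$ are diagonal (each has an orthonormal basis of eigenvectors), then condition 2 holds if and only if 5. $\dim\ker(\lambda I-W_0)=\dim\ker(\lambda I-\widetilde W_0)$ for all $\lambda\in\mathbb C$, where $\dim$ is the orthogonal (Hilbert space) dimension. -/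

import Mathlib

open MeasureTheory Set
open scoped InnerProductSpace ENNReal

universe u v

noncomputable section

section UnitaryEquivalence

/-- Two bounded operators are unitarily equivalent if a unitary isomorphism intertwines them. -/
def UnitarilyEquivalent {H : Type u} {K : Type v}
    [NormedAddCommGroup H] [InnerProductSpace ℂ H]
    [NormedAddCommGroup K] [InnerProductSpace ℂ K] (S : H →L[ℂ] H) (T : K →L[ℂ] K) : Prop :=
  ∃ U : H ≃ₗᵢ[ℂ] K, ∀ h : H, U (S h) = T (U h)

/-- The orthogonal dimension of a Hilbert space: the (least) cardinality of an orthonormal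
set whose linear span is dense.  (All such sets have the same cardinality.) -/
def hilbertDim (H : Type u) [NormedAddCommGroup H] [InnerProductSpace ℂ H] : Cardinal.{u} :=
  sInf {κ | ∃ s : Set H, Orthonormal ℂ (fun x : s => (x : H)) ∧
    (Submodule.span ℂ s).topologicalClosure = ⊤ ∧ Cardinal.mk s = κ}

/-- A bounded operator is diagonal if some orthonormal basis consists of its eigenvectors. -/
def IsDiagonal {H : Type u} [NormedAddCommGroup H] [InnerProductSpace ℂ H]
    (T : H →L[ℂ] H) : Prop :=
  ∃ (J : Type u) (e : HilbertBasis J ℂ H) (c : J → ℂ), ∀ j, T (e j) = c j • e j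

end UnitaryEquivalence

section Shifts

/-- `ℓ²_M`: the square summable sequences in the Hilbert space `M`. -/
abbrev EllTwo (M : Type u) [NormedAddCommGroup M] : Type u := lp (fun _ : ℕ => M) 2

/-- `W` is the operator valued unilateral weighted shift with weights `w 0, w 1, …`, that is,
`W (h₀, h₁, …) = (0, w₀ h₀, w₁ h₁, …)`. -/
def IsWeightedShift {M : Type u} [NormedAddCommGroup M] [InnerProductSpace ℂ M]
    (W : EllTwo M →L[ℂ] EllTwo M) (w : ℕ → M →L[ℂ] M) : Prop :=
  ∀ h : EllTwo M, W h 0 = 0 ∧ ∀ n : ℕ, W h (n + 1) = w n (h n)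

/-- The functions `ξₙ`; only their values on `[1, ∞)` matter. -/
def xi (n : ℕ) (x : ℝ) : ℝ :=
  Real.sqrt ((1 + ((n : ℝ) + 1) * (x ^ 2 - 1)) / (1 + (n : ℝ) * (x ^ 2 - 1)))

end Shifts

/-- A Borel spectral measure on the real line with values in the bounded operators on `H`: the
values on Borel sets are orthogonal projections, the whole line has value `I`, and `E` is
countably additive in the strong operator topology.  (Values on non-Borel sets are irrelevant
and are never used.)  A spectral measure on a Borel subset `S` of the line is regarded as
a spectral measure on the line with `E S = I`. -/
structure SpectralMeasure (H : Type u) [NormedAddCommGroup H] [InnerProductSpace ℂ H]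
    [CompleteSpace H] where
  /-- the value of the spectral measure on a set -/
  proj : Set ℝ → H →L[ℂ] H
  isStarProjection : ∀ Δ, MeasurableSet Δ → IsStarProjection (proj Δ)
  proj_univ : proj univ = 1
  hasSum_iUnion : ∀ s : ℕ → Set ℝ, (∀ i, MeasurableSet (s i)) →
    Pairwise (fun i j => Disjoint (s i) (s j)) →
    ∀ h : H, HasSum (fun i => proj (s i) h) (proj (⋃ i, s i) h)

namespace SpectralMeasure

variable {H : Type u} [NormedAddCommGroup H] [InnerProductSpace ℂ H] [CompleteSpace H]
variable {K : Type v} [NormedAddCommGroup K] [InnerProductSpace ℂ K] [CompleteSpace K]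

theorem proj_empty (E : SpectralMeasure H) (h : H) : E.proj ∅ h = 0 := by
  have hs := E.hasSum_iUnion (fun _ => ∅) (fun _ => MeasurableSet.empty)
    (fun _ _ _ => disjoint_bot_left) h
  exact (summable_const_iff (E.proj ∅ h)).1 hs.summable

theorem re_inner_nonneg (E : SpectralMeasure H) (h : H) {Δ : Set ℝ} (hΔ : MeasurableSet Δ) :
    0 ≤ (⟪h, E.proj Δ h⟫_ℂ).re := by
  have hp := E.isStarProjection Δ hΔ
  have h1 : E.proj Δ h = E.proj Δ (E.proj Δ h) := by
    conv_lhs => rw [← hp.isIdempotentElem.eq]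
    rfl
  have h2 : ⟪h, E.proj Δ h⟫_ℂ = ⟪E.proj Δ h, E.proj Δ h⟫_ℂ := by
    conv_lhs => rw [h1]
    rw [← ContinuousLinearMap.adjoint_inner_left]
    have := hp.isSelfAdjoint.star_eq
    rw [ContinuousLinearMap.star_eq_adjoint] at this
    rw [this]
  rw [h2]
  exact inner_self_nonneg (𝕜 := ℂ)

/-- The scalar spectral measure `Δ ↦ ⟨E(Δ)h, h⟩` of a vector `h`. -/
def scalarMeasure (E : SpectralMeasure H) (h : H) : Measure ℝ :=
  Measure.ofMeasurable (fun Δ _ => ENNReal.ofReal (⟪h, E.proj Δ h⟫_ℂ).re)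
    (by simp [E.proj_empty h])
    (by
      intro s hs hd
      have h1 := E.hasSum_iUnion s hs hd h
      have h2 : HasSum (fun i => (⟪h, E.proj (s i) h⟫_ℂ).re)
          (⟪h, E.proj (⋃ i, s i) h⟫_ℂ).re :=
        Complex.hasSum_re ((innerSL ℂ h).hasSum h1)
      rw [← h2.tsum_eq]
      exact ENNReal.ofReal_tsum_of_nonneg (fun i => E.re_inner_nonneg h (hs i)) h2.summable)

/-- The weak (quadratic form) characterization of `T = ∫ φ dE`:
`⟨T h, h⟩ = ∫ φ(x) ⟨E(dx)h, h⟩` for every `h`.  As `H` is a complex space, the operator `T` is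
determined by `E` and `φ`. -/
def HasIntegral (E : SpectralMeasure H) (φ : ℝ → ℝ) (T : H →L[ℂ] H) : Prop :=
  ∀ h : H, Integrable φ (E.scalarMeasure h) ∧
    ⟪h, T h⟫_ℂ = ((∫ x, φ x ∂(E.scalarMeasure h) : ℝ) : ℂ)

/-- `E` is carried by a compact subset of `S`. -/
def IsCompactlySupportedIn (E : SpectralMeasure H) (S : Set ℝ) : Prop :=
  ∃ C : Set ℝ, IsCompact C ∧ C ⊆ S ∧ E.proj C = 1

/-- `E` is the spectral measure of the bounded selfadjoint operator `A`, i.e. `A = ∫ x E(dx)`. -/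
def IsSpectralMeasureOf (E : SpectralMeasure H) (A : H →L[ℂ] H) : Prop :=
  E.IsCompactlySupportedIn univ ∧ E.HasIntegral (fun x => x) A

/-- Two spectral measures are unitarily equivalent: one unitary isomorphism intertwines
`E(Δ)` and `F(Δ)` for all Borel sets `Δ`. -/
def UnitarilyEquivalent (E : SpectralMeasure H) (F : SpectralMeasure K) : Prop :=
  ∃ U : H ≃ₗᵢ[ℂ] K, ∀ Δ : Set ℝ, MeasurableSet Δ →
    ∀ h : H, U (E.proj Δ h) = F.proj Δ (U h)

/-- The spectral type of a spectral measure on an arbitrary Hilbert space: the collection of all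
finite Borel measures that are absolutely continuous with respect to `⟨E(·)h, h⟩` for some
vector `h`.  If `H` is separable, there is a vector `h` of maximal type, the collection consists
of the finite measures absolutely continuous with respect to `⟨E(·)h, h⟩`, and so it
amounts to the measure class of `⟨E(·)h, h⟩`. -/
def spectralType (E : SpectralMeasure H) : Set (Measure ℝ) :=
  {μ | IsFiniteMeasure μ ∧ ∃ h : H, μ ≪ E.scalarMeasure h}

/-- `s` is a set of nonzero vectors which all have the scalar spectral measure `μ` and generate
mutually orthogonal cyclic subspaces. -/
def IsMultiplicityFamily (E : SpectralMeasure H) (μ : Measure ℝ) (s : Set H) : Prop :=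
  (∀ x ∈ s, x ≠ 0) ∧ (∀ x ∈ s, E.scalarMeasure x = μ) ∧
    ∀ x ∈ s, ∀ y ∈ s, x ≠ y → ∀ Δ : Set ℝ, MeasurableSet Δ → ⟪x, E.proj Δ y⟫_ℂ = 0

/-- The multiplicity function of a spectral measure on an arbitrary Hilbert space, a
cardinal-valued function of finite measures: `E.multiplicity μ` is the largest number of
copies of multiplication by the coordinate on `L²(μ)` that fit orthogonally into `E`
(it is `0` for `μ = 0`). -/
def multiplicity (E : SpectralMeasure H) (μ : Measure ℝ) : Cardinal.{u} :=
  ⨆ s : {s : Set H // E.IsMultiplicityFamily μ s}, Cardinal.mk s.1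

/-- The classical form, used on separable spaces, of the spectral type and multiplicity
function. The finite measure `μ` has the same null sets as `E`, and there is a generating
sequence of vectors with mutually orthogonal cyclic subspaces, the `k`-th of
which has scalar spectral measure `μ` restricted to `{n > k}`. In other words, `E` is the
canonical spectral measure of a direct integral `∫ ⊕ H(t) dμ(t)` with `dim H(t) = n(t)`. -/
def IsClassicalTypeAndMultiplicity (E : SpectralMeasure H) (μ : Measure ℝ) (n : ℝ → ℕ∞) : Prop :=
  IsFiniteMeasure μ ∧ (∀ Δ : Set ℝ, MeasurableSet Δ → (μ Δ = 0 ↔ E.proj Δ = 0)) ∧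
  Measurable n ∧
  ∃ x : ℕ → H,
    (∀ k : ℕ, E.scalarMeasure (x k) = μ.restrict {t | (k : ℕ∞) < n t}) ∧
    (∀ j k : ℕ, j ≠ k → ∀ Δ : Set ℝ, MeasurableSet Δ → ⟪x j, E.proj Δ (x k)⟫_ℂ = 0) ∧
    (Submodule.span ℂ {y : H | ∃ (k : ℕ) (Δ : Set ℝ), MeasurableSet Δ ∧
      y = E.proj Δ (x k)}).topologicalClosure = ⊤

end SpectralMeasure

section Invariants

variable {H K : Type u} [NormedAddCommGroup H] [InnerProductSpace ℂ H] [CompleteSpace H]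
variable [NormedAddCommGroup K] [InnerProductSpace ℂ K] [CompleteSpace K]

/-- The spectral types and the multiplicity functions of two bounded selfadjoint operators, i.e.
those of their spectral measures, coincide. -/
def SameTypeAndMultiplicity (A : H →L[ℂ] H) (B : K →L[ℂ] K) : Prop :=
  ∃ (E : SpectralMeasure H) (F : SpectralMeasure K),
    E.IsSpectralMeasureOf A ∧ F.IsSpectralMeasureOf B ∧
    E.spectralType = F.spectralType ∧
    ∀ μ : Measure ℝ, IsFiniteMeasure μ → E.multiplicity μ = F.multiplicity μ

/-- The class of `μ` is the spectral type of the bounded selfadjoint operator `A`, and `n` is its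
multiplicity function (on a separable space). -/
def IsClassicalTypeAndMultiplicity (A : H →L[ℂ] H) (μ : Measure ℝ) (n : ℝ → ℕ∞) : Prop :=
  ∃ E : SpectralMeasure H, E.IsSpectralMeasureOf A ∧ E.IsClassicalTypeAndMultiplicity μ n

end Invariants

end

-- Since `xi 0` is the identity on [1, ∞), the given E is the spectral measure of W₀. A bounded
-- selfadjoint operator determines its spectral measure (`IsSpectralMeasureOf.proj_eq`: equal
-- moments, then Weierstrass approximation), so conditions 2 and 4 agree. A unitary that intertwines
-- the spectral measures intertwines all weights (`HasIntegral.map_apply`), hence, acting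
-- coordinatewise, the shifts. Conversely, since every `xi n` is at least 1, the orthogonal
-- complement of the range of a shift is its zeroth coordinate space. A unitary between the shifts
-- therefore restricts to a unitary U₀ of these spaces; it preserves the norm of W₀a, so it
-- intertwines the squares of the zeroth weights, and then their positive square roots.
--
-- Condition 3 is Hellinger–Hahn theory without separability. The cyclic subspace of x is a copy of
-- L² of its scalar measure (`cyclicIsometry`). A complete family for ν splits the part of E on the
-- class of ν into copies of L²(ν); its cardinality is the multiplicity of ν
-- (`IsCompleteFamily.mk_le_of_eq`), and every nonzero ν has a nonzero restriction with such a
-- family (`exists_isCompleteFamily_restrict`). If the multiplicity functions agree, a maximal set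
-- of mutually singular measures with equally indexed complete families on both sides exhausts both
-- spaces, and matching the generators gives a unitary (`UnitarilyEquivalent.of_multiplicity_eq`).
-- Thus the multiplicity function alone is a complete invariant.
--
-- In the separable case an orthogonal sequence of cyclic vectors is regrouped so that the fibre
-- over t uses the first n(t) indices, and the cardinality bound makes n unique almost everywhere.
-- In the diagonal case orthonormal bases of corresponding eigenspaces are matched.

noncomputable section

-- Isometries obtained from equal Gram matrices

section Gram

variable {ι : Type*} {H₁ H₂ : Type*} [NormedAddCommGroup H₁] [InnerProductSpace ℂ H₁]
  [NormedAddCommGroup H₂] [InnerProductSpace ℂ H₂]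

theorem span_topologicalClosure_eq_top_of_forall_inner [CompleteSpace H₁] {s : Set H₁}
    (hs : ∀ z, (∀ x ∈ s, ⟪x, z⟫_ℂ = 0) → z = 0) :
    (Submodule.span ℂ s).topologicalClosure = ⊤ := by
  rw [Submodule.topologicalClosure_eq_top_iff, Submodule.eq_bot_iff]
  intro z hz
  exact hs z fun x hx => hz x (Submodule.subset_span hx)

theorem eq_zero_of_span_topologicalClosure_eq_top {s : Set H₁}
    (hs : (Submodule.span ℂ s).topologicalClosure = ⊤) {z : H₁} (hz : ∀ x ∈ s, ⟪x, z⟫_ℂ = 0) :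
    z = 0 := by
  have h1 : (Submodule.span ℂ s) ≤ (ℂ ∙ z)ᗮ := by
    rw [Submodule.span_le]
    intro x hx
    rw [SetLike.mem_coe, Submodule.mem_orthogonal_singleton_iff_inner_left]
    exact hz x hx
  have h2 := Submodule.topologicalClosure_minimal _ h1 (Submodule.isClosed_orthogonal _)
  rw [hs] at h2
  have h3 : z ∈ (ℂ ∙ z)ᗮ := h2 trivial
  rw [Submodule.mem_orthogonal_singleton_iff_inner_left] at h3
  simpa using h3

theorem inner_linearCombination (a : ι → H₁) (b : ι → H₂)
    (hab : ∀ i j, ⟪a i, a j⟫_ℂ = ⟪b i, b j⟫_ℂ) (f g : ι →₀ ℂ) :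
    ⟪Finsupp.linearCombination ℂ a f, Finsupp.linearCombination ℂ a g⟫_ℂ =
      ⟪Finsupp.linearCombination ℂ b f, Finsupp.linearCombination ℂ b g⟫_ℂ := by
  simp [Finsupp.linearCombination_apply, Finsupp.sum, hab]

/-- Two families with the same Gram matrix, the first of them total, are matched by an isometry. -/
theorem exists_linearIsometry_of_inner_eq [CompleteSpace H₂] (a : ι → H₁) (b : ι → H₂)
    (hab : ∀ i j, ⟪a i, a j⟫_ℂ = ⟪b i, b j⟫_ℂ)
    (ha : (Submodule.span ℂ (range a)).topologicalClosure = ⊤) :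
    ∃ V : H₁ →ₗᵢ[ℂ] H₂, ∀ i, V (a i) = b i := by
  set la := Finsupp.linearCombination ℂ a with hla
  set lb := Finsupp.linearCombination ℂ b with hlb
  have hnorm : ∀ f, ‖lb f‖ = ‖la f‖ := fun f => by
    rw [@norm_eq_sqrt_re_inner ℂ, @norm_eq_sqrt_re_inner ℂ, inner_linearCombination a b hab]
  have hd : DenseRange la := by
    have h : (range la : Set H₁) = Submodule.span ℂ (range a) := by
      rw [← Finsupp.range_linearCombination]; rfl
    rwa [DenseRange, h, Submodule.dense_iff_topologicalClosure_eq_top]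
  have hle : ∀ f, ‖lb f‖ ≤ 1 * ‖la f‖ := fun f => by rw [hnorm, one_mul]
  set V := lb.extendOfNorm la with hV
  have hVeq : ∀ f, V (la f) = lb f := LinearMap.extendOfNorm_eq hd ⟨1, hle⟩
  refine ⟨⟨V.toLinearMap, fun x => ?_⟩, fun i => ?_⟩
  · refine hd.induction_on (p := fun x => ‖V x‖ = ‖x‖) x ?_ fun f => ?_
    · exact isClosed_eq (by fun_prop) (by fun_prop)
    · rw [hVeq, hnorm]
  · have := hVeq (Finsupp.single i 1)
    simpa [hla, hlb] using this

/-- Two total families with the same Gram matrix are matched by a unitary. -/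
theorem exists_linearIsometryEquiv_of_inner_eq [CompleteSpace H₁] [CompleteSpace H₂]
    (a : ι → H₁) (b : ι → H₂) (hab : ∀ i j, ⟪a i, a j⟫_ℂ = ⟪b i, b j⟫_ℂ)
    (ha : (Submodule.span ℂ (range a)).topologicalClosure = ⊤)
    (hb : (Submodule.span ℂ (range b)).topologicalClosure = ⊤) :
    ∃ U : H₁ ≃ₗᵢ[ℂ] H₂, ∀ i, U (a i) = b i := by
  obtain ⟨V, hV⟩ := exists_linearIsometry_of_inner_eq a b hab ha
  obtain ⟨V', hV'⟩ := exists_linearIsometry_of_inner_eq b a (fun i j => (hab i j).symm) hb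
  have hVV : ∀ x, V (V' x) = x := by
    have h : (V.comp V').toContinuousLinearMap = ContinuousLinearMap.id ℂ H₂ := by
      refine ContinuousLinearMap.ext_on (s := range b) ?_ ?_
      · rwa [← Submodule.dense_iff_topologicalClosure_eq_top] at hb
      · rintro _ ⟨i, rfl⟩
        simp [hV, hV']
    intro x
    exact congrArg (fun T : H₂ →L[ℂ] H₂ => T x) h
  exact ⟨LinearIsometryEquiv.ofSurjective V fun y => ⟨V' y, hVV y⟩, hV⟩

/-- Complex polarization; it makes the quadratic form definition `HasIntegral` determine the
operator. -/
theorem continuousLinearMap_eq_of_inner_self {S T : H₁ →L[ℂ] H₁}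
    (h : ∀ x, ⟪x, S x⟫_ℂ = ⟪x, T x⟫_ℂ) : S = T := by
  have h1 : S.toLinearMap = T.toLinearMap := by
    rw [← ext_inner_map]
    intro x
    have := congrArg (starRingEnd ℂ) (h x)
    rw [inner_conj_symm, inner_conj_symm] at this
    exact this
  exact ContinuousLinearMap.coe_injective h1

end Gram

namespace SpectralMeasure

variable {H : Type u} [NormedAddCommGroup H] [InnerProductSpace ℂ H] [CompleteSpace H]
variable {K : Type v} [NormedAddCommGroup K] [InnerProductSpace ℂ K] [CompleteSpace K]
variable (E : SpectralMeasure H) (F : SpectralMeasure K)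

-- Algebra of spectral projections and scalar measures

section Basic

theorem proj_union {Δ Δ' : Set ℝ} (hΔ : MeasurableSet Δ) (hΔ' : MeasurableSet Δ')
    (hd : Disjoint Δ Δ') (h : H) : E.proj (Δ ∪ Δ') h = E.proj Δ h + E.proj Δ' h := by
  -- Finite additivity from countable additivity: pad the pair with empty sets.
  let s : ℕ → Set ℝ := fun n => if n = 0 then Δ else if n = 1 then Δ' else ∅
  have hs : ∀ n, MeasurableSet (s n) := by
    intro n; simp only [s]; split_ifs <;> simp [hΔ, hΔ']
  have hp : Pairwise fun i j => Disjoint (s i) (s j) := by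
    intro i j hij
    simp only [s]
    split_ifs <;> first | omega | simp [hd.symm]
  have hu : ⋃ n, s n = Δ ∪ Δ' := by
    ext t
    simp only [mem_iUnion, mem_union, s]
    constructor
    · rintro ⟨n, hn⟩; split_ifs at hn <;> simp_all
    · rintro (ht | ht)
      · exact ⟨0, by simpa using ht⟩
      · exact ⟨1, by simpa using ht⟩
  have h1 := E.hasSum_iUnion s hs hp h
  rw [hu] at h1
  have h2 : HasSum (fun i => E.proj (s i) h) (∑ i ∈ {0, 1}, E.proj (s i) h) := by
    refine hasSum_sum_of_ne_finset_zero fun n hn => ?_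
    simp only [Finset.mem_insert, Finset.mem_singleton, not_or] at hn
    simp [s, hn.1, hn.2, E.proj_empty]
  rw [h1.unique h2]
  simp [s]

theorem proj_proj_self {Δ : Set ℝ} (hΔ : MeasurableSet Δ) (h : H) :
    E.proj Δ (E.proj Δ h) = E.proj Δ h :=
  congrArg (fun T : H →L[ℂ] H => T h) (E.isStarProjection Δ hΔ).isIdempotentElem.eq

theorem inner_proj_left {Δ : Set ℝ} (hΔ : MeasurableSet Δ) (x y : H) :
    ⟪E.proj Δ x, y⟫_ℂ = ⟪x, E.proj Δ y⟫_ℂ := by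
  have := (E.isStarProjection Δ hΔ).isSelfAdjoint.star_eq
  rw [ContinuousLinearMap.star_eq_adjoint] at this
  conv_lhs => rw [← this]
  exact ContinuousLinearMap.adjoint_inner_left _ _ _

/-- With P = E(Δ) and Q = E(Δ'), the sum P + Q = E(Δ ∪ Δ') is again idempotent. On x in the range of
Q this yields Px + QPx = 0; applying Q kills QPx, and then Px = 0. -/
theorem proj_proj_of_disjoint {Δ Δ' : Set ℝ} (hΔ : MeasurableSet Δ) (hΔ' : MeasurableSet Δ')
    (hd : Disjoint Δ Δ') (h : H) : E.proj Δ (E.proj Δ' h) = 0 := by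
  set x := E.proj Δ' h with hx
  have hx' : E.proj Δ' x = x := E.proj_proj_self hΔ' h
  have h1 : E.proj (Δ ∪ Δ') x = E.proj Δ x + x := by rw [E.proj_union hΔ hΔ' hd, hx']
  have h2 := E.proj_proj_self (hΔ.union hΔ') x
  rw [h1, map_add, h1, E.proj_union hΔ hΔ' hd, E.proj_proj_self hΔ] at h2
  have h3 : E.proj Δ x + E.proj Δ' (E.proj Δ x) = 0 := by
    rw [← add_assoc] at h2
    simpa using h2
  have h4 := congrArg (fun y => E.proj Δ y) h3
  have h5 := congrArg (fun y => E.proj Δ' y) h3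
  simp only [map_add, E.proj_proj_self hΔ, E.proj_proj_self hΔ', map_zero] at h4 h5
  have h6 : E.proj Δ' (E.proj Δ x) = 0 := by
    rw [← two_smul ℂ] at h5
    simpa using h5
  simpa [h6] using h3

/-- Multiplicativity is a consequence of additivity: split Δ' into its parts inside and outside Δ
and use the disjoint case. -/
theorem proj_proj {Δ Δ' : Set ℝ} (hΔ : MeasurableSet Δ) (hΔ' : MeasurableSet Δ') (h : H) :
    E.proj Δ (E.proj Δ' h) = E.proj (Δ ∩ Δ') h := by
  have h1 : E.proj Δ' h = E.proj (Δ ∩ Δ') h + E.proj (Δ' \ Δ) h := by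
    rw [← E.proj_union (hΔ.inter hΔ') (hΔ'.diff hΔ)
      (disjoint_sdiff_self_right.mono_left inter_subset_left)]
    congr 2
    rw [inter_comm, inter_union_sdiff]
  have h2 : E.proj Δ (E.proj (Δ ∩ Δ') h) = E.proj (Δ ∩ Δ') h := by
    have h3 : E.proj Δ (E.proj (Δ ∩ Δ') h) + E.proj Δᶜ (E.proj (Δ ∩ Δ') h) =
        E.proj (Δ ∩ Δ') h := by
      rw [← E.proj_union hΔ hΔ.compl disjoint_compl_right, union_compl_self, E.proj_univ]
      rfl
    rwa [E.proj_proj_of_disjoint hΔ.compl (hΔ.inter hΔ')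
      (disjoint_compl_left.mono_right inter_subset_left), add_zero] at h3
  rw [h1, map_add, h2, E.proj_proj_of_disjoint hΔ (hΔ'.diff hΔ) disjoint_sdiff_self_right,
    add_zero]

theorem proj_comm {Δ Δ' : Set ℝ} (hΔ : MeasurableSet Δ) (hΔ' : MeasurableSet Δ') (h : H) :
    E.proj Δ (E.proj Δ' h) = E.proj Δ' (E.proj Δ h) := by
  rw [E.proj_proj hΔ hΔ', E.proj_proj hΔ' hΔ, inter_comm]

theorem proj_add_proj_compl {Δ : Set ℝ} (hΔ : MeasurableSet Δ) (h : H) :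
    E.proj Δ h + E.proj Δᶜ h = h := by
  rw [← E.proj_union hΔ hΔ.compl disjoint_compl_right, union_compl_self, E.proj_univ]
  rfl

theorem inner_proj_proj {Δ Δ' : Set ℝ} (hΔ : MeasurableSet Δ) (hΔ' : MeasurableSet Δ')
    (x y : H) : ⟪E.proj Δ x, E.proj Δ' y⟫_ℂ = ⟪x, E.proj (Δ ∩ Δ') y⟫_ℂ := by
  rw [E.inner_proj_left hΔ, E.proj_proj hΔ hΔ']

theorem inner_proj_self {Δ : Set ℝ} (hΔ : MeasurableSet Δ) (x : H) :
    ⟪x, E.proj Δ x⟫_ℂ = ((‖E.proj Δ x‖ ^ 2 : ℝ) : ℂ) := by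
  rw [← E.proj_proj_self hΔ, ← E.inner_proj_left hΔ, E.proj_proj_self hΔ,
    inner_self_eq_norm_sq_to_K]
  norm_cast

theorem scalarMeasure_apply {Δ : Set ℝ} (hΔ : MeasurableSet Δ) (x : H) :
    E.scalarMeasure x Δ = ENNReal.ofReal (‖E.proj Δ x‖ ^ 2) := by
  rw [scalarMeasure, Measure.ofMeasurable_apply _ hΔ, E.inner_proj_self hΔ, Complex.ofReal_re]

theorem scalarMeasure_univ (x : H) : E.scalarMeasure x univ = ENNReal.ofReal (‖x‖ ^ 2) := by
  rw [E.scalarMeasure_apply .univ, E.proj_univ]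
  rfl

instance isFiniteMeasure_scalarMeasure (x : H) : IsFiniteMeasure (E.scalarMeasure x) :=
  ⟨by rw [E.scalarMeasure_univ]; exact ENNReal.ofReal_lt_top⟩

theorem scalarMeasure_real {Δ : Set ℝ} (hΔ : MeasurableSet Δ) (x : H) :
    (E.scalarMeasure x).real Δ = ‖E.proj Δ x‖ ^ 2 := by
  rw [measureReal_def, E.scalarMeasure_apply hΔ, ENNReal.toReal_ofReal (by positivity)]

theorem inner_proj_self_eq_real {Δ : Set ℝ} (hΔ : MeasurableSet Δ) (x : H) :
    ⟪x, E.proj Δ x⟫_ℂ = ((E.scalarMeasure x).real Δ : ℂ) := by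
  rw [E.inner_proj_self hΔ, E.scalarMeasure_real hΔ]

theorem scalarMeasure_eq_zero_iff {Δ : Set ℝ} (hΔ : MeasurableSet Δ) (x : H) :
    E.scalarMeasure x Δ = 0 ↔ E.proj Δ x = 0 := by
  rw [E.scalarMeasure_apply hΔ, ENNReal.ofReal_eq_zero]
  constructor
  · intro h
    have : ‖E.proj Δ x‖ ^ 2 = 0 := le_antisymm h (by positivity)
    simpa using this
  · intro h; simp [h]

theorem scalarMeasure_eq_zero {x : H} : E.scalarMeasure x = 0 ↔ x = 0 := by
  rw [← Measure.measure_univ_eq_zero, E.scalarMeasure_eq_zero_iff .univ, E.proj_univ]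
  rfl

theorem scalarMeasure_proj {Δ : Set ℝ} (hΔ : MeasurableSet Δ) (x : H) :
    E.scalarMeasure (E.proj Δ x) = (E.scalarMeasure x).restrict Δ := by
  ext s hs
  rw [Measure.restrict_apply hs, E.scalarMeasure_apply hs, E.scalarMeasure_apply (hs.inter hΔ),
    E.proj_proj hs hΔ]

theorem scalarMeasure_absolutelyContinuous_iff {ν : Measure ℝ} {x : H} :
    E.scalarMeasure x ≪ ν ↔ ∀ Δ, MeasurableSet Δ → ν Δ = 0 → E.proj Δ x = 0 := by
  constructor
  · intro h Δ hΔ h0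
    exact (E.scalarMeasure_eq_zero_iff hΔ x).1 (h h0)
  · intro h
    refine Measure.AbsolutelyContinuous.mk fun s hs h0 => ?_
    exact (E.scalarMeasure_eq_zero_iff hs x).2 (h s hs h0)

theorem proj_eq_self_of_compl {Δ : Set ℝ} (hΔ : MeasurableSet Δ) {x : H}
    (h : E.proj Δᶜ x = 0) : E.proj Δ x = x := by
  have := E.proj_add_proj_compl hΔ x
  rwa [h, add_zero] at this

theorem proj_eq_self_of_ac_restrict {ν : Measure ℝ} {Δ : Set ℝ} (hΔ : MeasurableSet Δ) {x : H}
    (h : E.scalarMeasure x ≪ ν.restrict Δ) : E.proj Δ x = x := by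
  refine E.proj_eq_self_of_compl hΔ ((E.scalarMeasure_absolutelyContinuous_iff.1 h) _ hΔ.compl ?_)
  rw [Measure.restrict_apply hΔ.compl, compl_inter_self, measure_empty]

end Basic

-- Orthogonality of cyclic subspaces

section CyclicOrth

/-- The cyclic subspaces generated by `x` and by `y` are orthogonal. -/
def CyclicOrth (x y : H) : Prop := ∀ Δ : Set ℝ, MeasurableSet Δ → ⟪x, E.proj Δ y⟫_ℂ = 0

/-- The cyclic subspaces generated by the vectors of a family span a dense subspace. -/
def IsTotal {ι : Type*} (x : ι → H) : Prop := ∀ z, (∀ i, E.CyclicOrth (x i) z) → z = 0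

variable {E}

theorem CyclicOrth.symm {x y : H} (h : E.CyclicOrth x y) : E.CyclicOrth y x := fun Δ hΔ => by
  rw [← E.inner_proj_left hΔ, ← inner_conj_symm, h Δ hΔ, map_zero]

theorem CyclicOrth.proj_right {x y : H} (h : E.CyclicOrth x y) {Δ : Set ℝ}
    (hΔ : MeasurableSet Δ) : E.CyclicOrth x (E.proj Δ y) := fun Δ' hΔ' => by
  rw [E.proj_proj hΔ' hΔ, h _ (hΔ'.inter hΔ)]

theorem CyclicOrth.proj_left {x y : H} (h : E.CyclicOrth x y) {Δ : Set ℝ}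
    (hΔ : MeasurableSet Δ) : E.CyclicOrth (E.proj Δ x) y := (h.symm.proj_right hΔ).symm

theorem CyclicOrth.inner_proj {x y : H} (h : E.CyclicOrth x y) {Δ Δ' : Set ℝ}
    (hΔ : MeasurableSet Δ) (hΔ' : MeasurableSet Δ') : ⟪E.proj Δ x, E.proj Δ' y⟫_ℂ = 0 := by
  rw [E.inner_proj_proj hΔ hΔ', h _ (hΔ.inter hΔ')]

theorem CyclicOrth.inner_eq_zero {x y : H} (h : E.CyclicOrth x y) : ⟪x, y⟫_ℂ = 0 := by
  have := h univ .univ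
  rwa [E.proj_univ] at this

theorem CyclicOrth.of_hasSum {ι : Type*} {x z : H} {y : ι → H} (hy : ∀ i, E.CyclicOrth x (y i))
    (hz : HasSum y z) : E.CyclicOrth x z := fun Δ hΔ => by
  have h1 := (innerSL ℂ x).hasSum ((E.proj Δ).hasSum hz)
  have h2 : (fun i => innerSL ℂ x (E.proj Δ (y i))) = fun _ => 0 :=
    funext fun i => hy i Δ hΔ
  rw [h2] at h1
  exact h1.unique hasSum_zero

theorem cyclicOrth_zero_left (y : H) : E.CyclicOrth 0 y := fun _ _ => inner_zero_left _

/-- A vector that is cyclically orthogonal to itself vanishes. -/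
theorem CyclicOrth.self_eq_zero {x : H} (h : E.CyclicOrth x x) : x = 0 := by
  simpa using h.inner_eq_zero

theorem cyclicOrth_proj_proj_of_disjoint {Δ Δ' : Set ℝ} (hΔ : MeasurableSet Δ)
    (hΔ' : MeasurableSet Δ') (hd : Disjoint Δ Δ') (x y : H) :
    E.CyclicOrth (E.proj Δ x) (E.proj Δ' y) := fun s hs => by
  rw [E.proj_proj hs hΔ', E.inner_proj_proj hΔ (hs.inter hΔ')]
  have : Δ ∩ (s ∩ Δ') = ∅ :=
    (hd.mono_right inter_subset_right).inter_eq
  rw [this, E.proj_empty, inner_zero_right]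

/-- Mutually singular scalar measures place the two vectors in the ranges of complementary spectral
projections. -/
theorem cyclicOrth_of_mutuallySingular {x y : H}
    (h : E.scalarMeasure x ⟂ₘ E.scalarMeasure y) : E.CyclicOrth x y := by
  obtain ⟨s, hs, hx, hy⟩ := h
  rw [E.scalarMeasure_eq_zero_iff hs] at hx
  rw [E.scalarMeasure_eq_zero_iff hs.compl] at hy
  have hx' : E.proj sᶜ x = x := E.proj_eq_self_of_compl hs.compl (by rwa [compl_compl])
  have hy' : E.proj s y = y := E.proj_eq_self_of_compl hs hy
  rw [← hx', ← hy']
  exact cyclicOrth_proj_proj_of_disjoint hs.compl hs disjoint_compl_left x y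

theorem IsTotal.topologicalClosure_eq_top {ι : Type*} {x : ι → H} (hx : E.IsTotal x) :
    (Submodule.span ℂ (range fun p : ι × {Δ : Set ℝ // MeasurableSet Δ} =>
      E.proj p.2.1 (x p.1))).topologicalClosure = ⊤ := by
  refine span_topologicalClosure_eq_top_of_forall_inner fun z hz => hx z fun i Δ hΔ => ?_
  rw [← E.inner_proj_left hΔ]
  exact hz _ ⟨(i, ⟨Δ, hΔ⟩), rfl⟩

theorem isTotal_of_topologicalClosure_eq_top {x : ℕ → H}
    (hx : (Submodule.span ℂ {y : H | ∃ (k : ℕ) (Δ : Set ℝ), MeasurableSet Δ ∧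
      y = E.proj Δ (x k)}).topologicalClosure = ⊤) : E.IsTotal x := by
  intro z hz
  refine eq_zero_of_span_topologicalClosure_eq_top hx ?_
  rintro _ ⟨k, Δ, hΔ, rfl⟩
  rw [E.inner_proj_left hΔ]
  exact hz k Δ hΔ

/-- Spectral measures with total orthogonal families of the same scalar spectral measures are
unitarily equivalent. -/
theorem UnitarilyEquivalent.of_isTotal {F : SpectralMeasure K} {ι : Type*} {x : ι → H} {y : ι → K}
    (hx : E.IsTotal x) (hy : F.IsTotal y) (hxo : Pairwise fun i j => E.CyclicOrth (x i) (x j))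
    (hyo : Pairwise fun i j => F.CyclicOrth (y i) (y j))
    (hxy : ∀ i, E.scalarMeasure (x i) = F.scalarMeasure (y i)) : E.UnitarilyEquivalent F := by
  let a : ι × {Δ : Set ℝ // MeasurableSet Δ} → H := fun p => E.proj p.2.1 (x p.1)
  let b : ι × {Δ : Set ℝ // MeasurableSet Δ} → K := fun p => F.proj p.2.1 (y p.1)
  -- The Gram matrix is known from the scalar measures: zero for different indices, the mass of Δ ∩
  -- Δ' for equal ones.
  have hab : ∀ p q, ⟪a p, a q⟫_ℂ = ⟪b p, b q⟫_ℂ := by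
    rintro ⟨i, Δ, hΔ⟩ ⟨j, Δ', hΔ'⟩
    simp only [a, b]
    by_cases hij : i = j
    · subst hij
      rw [E.inner_proj_proj hΔ hΔ', F.inner_proj_proj hΔ hΔ',
        E.inner_proj_self_eq_real (hΔ.inter hΔ'), F.inner_proj_self_eq_real (hΔ.inter hΔ'), hxy]
    · rw [(hxo hij).inner_proj hΔ hΔ', (hyo hij).inner_proj hΔ hΔ']
  obtain ⟨U, hU⟩ := exists_linearIsometryEquiv_of_inner_eq a b hab hx.topologicalClosure_eq_top
    hy.topologicalClosure_eq_top
  refine ⟨U, fun Δ hΔ h => ?_⟩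
  have h1 : (U.toContinuousLinearEquiv : H →L[ℂ] K) ∘L E.proj Δ =
      F.proj Δ ∘L (U.toContinuousLinearEquiv : H →L[ℂ] K) := by
    refine ContinuousLinearMap.ext_on (s := range a) ?_ ?_
    · rw [Submodule.dense_iff_topologicalClosure_eq_top]
      exact hx.topologicalClosure_eq_top
    · rintro _ ⟨⟨i, Δ', hΔ'⟩, rfl⟩
      have h2 := hU (i, ⟨Δ', hΔ'⟩)
      have h3 := hU (i, ⟨Δ ∩ Δ', hΔ.inter hΔ'⟩)
      simp only [a, b] at h2 h3 ⊢
      simp [E.proj_proj hΔ hΔ', h2, h3, F.proj_proj hΔ hΔ']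
  exact congrArg (fun T : H →L[ℂ] K => T h) h1

end CyclicOrth

end SpectralMeasure

namespace SpectralMeasure

variable {H : Type u} [NormedAddCommGroup H] [InnerProductSpace ℂ H] [CompleteSpace H]
variable {E : SpectralMeasure H} {ν : Measure ℝ} [IsFiniteMeasure ν] {x : H}

-- The cyclic subspace of a vector as an L² space

section CyclicIsometry

/-- Indicators in L²(ν) and the vectors E(Δ)x have the same Gram matrix ν(Δ ∩ Δ'), and indicators
are total because an integrable function with vanishing set integrals is zero. -/
theorem exists_cyclicIsometry (hx : E.scalarMeasure x = ν) :
    ∃ V : Lp ℂ 2 ν →ₗᵢ[ℂ] H, ∀ (Δ : Set ℝ) (hΔ : MeasurableSet Δ),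
      V (indicatorConstLp 2 hΔ (measure_ne_top ν Δ) 1) = E.proj Δ x := by
  let a : {Δ : Set ℝ // MeasurableSet Δ} → Lp ℂ 2 ν :=
    fun Δ => indicatorConstLp 2 Δ.2 (measure_ne_top ν Δ.1) 1
  let b : {Δ : Set ℝ // MeasurableSet Δ} → H := fun Δ => E.proj Δ.1 x
  obtain ⟨V, hV⟩ := exists_linearIsometry_of_inner_eq a b (fun Δ Δ' => by
    simp only [a, b]
    rw [L2.inner_indicatorConstLp_one_indicatorConstLp_one, E.inner_proj_proj Δ.2 Δ'.2,
      E.inner_proj_self_eq_real (Δ.2.inter Δ'.2), hx]; rfl)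
    (span_topologicalClosure_eq_top_of_forall_inner fun f hf => by
      have hf' : ∀ s, MeasurableSet s → ν s < ∞ → ∫ t in s, f t ∂ν = 0 := fun s hs _ => by
        rw [← L2.inner_indicatorConstLp_one (𝕜 := ℂ) hs (measure_ne_top ν s)]
        exact hf _ ⟨⟨s, hs⟩, rfl⟩
      have hi : Integrable f ν := (Lp.memLp f).integrable (by norm_num)
      exact (Lp.eq_zero_iff_ae_eq_zero).2 (hi.ae_eq_zero_of_forall_setIntegral_eq_zero hf'))
  exact ⟨V, fun Δ hΔ => hV ⟨Δ, hΔ⟩⟩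

/-- The isometry of `L²(ν)` onto the cyclic subspace generated by a vector `x` with scalar
spectral measure `ν`. -/
def cyclicIsometry (hx : E.scalarMeasure x = ν) : Lp ℂ 2 ν →ₗᵢ[ℂ] H :=
  (exists_cyclicIsometry hx).choose

theorem cyclicIsometry_indicator (hx : E.scalarMeasure x = ν) {Δ : Set ℝ}
    (hΔ : MeasurableSet Δ) :
    cyclicIsometry hx (indicatorConstLp 2 hΔ (measure_ne_top ν Δ) 1) = E.proj Δ x :=
  (exists_cyclicIsometry hx).choose_spec Δ hΔ

/-- The adjoint of `cyclicIsometry`: the density of `Δ ↦ ⟪x, E(Δ) z⟫` with respect to `ν`. -/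
def cyclicCoeff (hx : E.scalarMeasure x = ν) (z : H) : Lp ℂ 2 ν :=
  ContinuousLinearMap.adjoint (cyclicIsometry hx).toContinuousLinearMap z

theorem inner_cyclicCoeff (hx : E.scalarMeasure x = ν) (f : Lp ℂ 2 ν) (z : H) :
    ⟪f, cyclicCoeff hx z⟫_ℂ = ⟪cyclicIsometry hx f, z⟫_ℂ :=
  ContinuousLinearMap.adjoint_inner_right _ _ _

theorem cyclicCoeff_cyclicIsometry (hx : E.scalarMeasure x = ν) (f : Lp ℂ 2 ν) :
    cyclicCoeff hx (cyclicIsometry hx f) = f := by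
  refine ext_inner_left ℂ fun g => ?_
  rw [inner_cyclicCoeff, LinearIsometry.inner_map_map]

theorem setIntegral_cyclicCoeff (hx : E.scalarMeasure x = ν) (z : H) {Δ : Set ℝ}
    (hΔ : MeasurableSet Δ) : ∫ t in Δ, cyclicCoeff hx z t ∂ν = ⟪x, E.proj Δ z⟫_ℂ := by
  rw [← L2.inner_indicatorConstLp_one (𝕜 := ℂ) hΔ (measure_ne_top ν Δ), inner_cyclicCoeff,
    cyclicIsometry_indicator, E.inner_proj_left hΔ]

theorem integrable_coe_lp_two (f : Lp ℂ 2 ν) : Integrable f ν :=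
  (Lp.memLp f).integrable (by norm_num)

/-- An integrable function is determined by its set integrals; concrete coefficients are identified
this way below. -/
theorem cyclicCoeff_ae_eq (hx : E.scalarMeasure x = ν) (z : H) {f : ℝ → ℂ} (hf : Integrable f ν)
    (h : ∀ Δ, MeasurableSet Δ → ∫ t in Δ, f t ∂ν = ⟪x, E.proj Δ z⟫_ℂ) :
    cyclicCoeff hx z =ᵐ[ν] f :=
  (integrable_coe_lp_two _).ae_eq_of_forall_setIntegral_eq _ _ hf fun s hs _ => by
    rw [setIntegral_cyclicCoeff hx z hs, h s hs]

theorem cyclicCoeff_eq_zero_iff (hx : E.scalarMeasure x = ν) {z : H} :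
    cyclicCoeff hx z = 0 ↔ E.CyclicOrth x z := by
  constructor
  · intro h Δ hΔ
    rw [← E.inner_proj_left hΔ, ← cyclicIsometry_indicator hx hΔ, ← inner_cyclicCoeff, h,
      inner_zero_right]
  · intro h
    rw [Lp.eq_zero_iff_ae_eq_zero]
    exact cyclicCoeff_ae_eq hx z (integrable_zero _ _ _) fun Δ hΔ => by simp [h Δ hΔ]

theorem cyclicCoeff_proj (hx : E.scalarMeasure x = ν) (z : H) {Δ : Set ℝ}
    (hΔ : MeasurableSet Δ) :
    cyclicCoeff hx (E.proj Δ z) =ᵐ[ν] Δ.indicator (cyclicCoeff hx z) :=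
  cyclicCoeff_ae_eq hx _ ((integrable_coe_lp_two _).indicator hΔ) fun s hs => by
    rw [integral_indicator hΔ, Measure.restrict_restrict hΔ,
      setIntegral_cyclicCoeff hx z (hΔ.inter hs), E.proj_proj hs hΔ, inter_comm]

/-- With V the cyclic isometry, V*V = 1, so VV* is the projection onto the cyclic subspace and V*
kills the remainder. -/
theorem cyclicOrth_sub_cyclicIsometry (hx : E.scalarMeasure x = ν) (z : H) :
    E.CyclicOrth x (z - cyclicIsometry hx (cyclicCoeff hx z)) := by
  rw [← cyclicCoeff_eq_zero_iff hx, cyclicCoeff, map_sub, ← cyclicCoeff, ← cyclicCoeff,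
    cyclicCoeff_cyclicIsometry, sub_self]

theorem CyclicOrth.cyclicIsometry {z : H} (h : E.CyclicOrth x z) (hx : E.scalarMeasure x = ν)
    (f : Lp ℂ 2 ν) : E.CyclicOrth (SpectralMeasure.cyclicIsometry hx f) z := fun Δ hΔ => by
  rw [← inner_cyclicCoeff, (cyclicCoeff_eq_zero_iff hx).2 (h.proj_right hΔ), inner_zero_right]

/-- Invariance of the cyclic subspace under E(Δ): for w = E(Δ)Vf the remainder w − VV*w is
orthogonal both to w and to VV*w, hence to itself. -/
theorem proj_cyclicIsometry (hx : E.scalarMeasure x = ν) (f : Lp ℂ 2 ν) {Δ : Set ℝ}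
    (hΔ : MeasurableSet Δ) : E.proj Δ (cyclicIsometry hx f) =
      cyclicIsometry hx (cyclicCoeff hx (E.proj Δ (cyclicIsometry hx f))) := by
  set w := E.proj Δ (cyclicIsometry hx f) with hw
  have hr := cyclicOrth_sub_cyclicIsometry hx w
  have h1 := ((hr.cyclicIsometry hx f).proj_left hΔ).inner_eq_zero
  have h2 := (hr.cyclicIsometry hx (cyclicCoeff hx w)).inner_eq_zero
  rw [← hw] at h1
  refine sub_eq_zero.1 (inner_self_eq_zero (𝕜 := ℂ).1 ?_)
  rw [inner_sub_left, h1, h2, sub_zero]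

theorem norm_sq_lp_two {μ : Measure ℝ} (f : Lp ℂ 2 μ) :
    ENNReal.ofReal (‖f‖ ^ 2) = ∫⁻ t, ‖f t‖ₑ ^ 2 ∂μ := by
  have h := eLpNorm_nnreal_pow_eq_lintegral (f := f) (μ := μ) (p := 2) (by norm_num)
  rw [ENNReal.ofReal_pow (norm_nonneg _), Lp.norm_def, ENNReal.ofReal_toReal (Lp.eLpNorm_ne_top f)]
  simpa using h

/-- In the L² picture E(Δ) multiplies by the indicator of Δ, so the squared norm of E(Δ)Vf is the
integral of |f|² over Δ. -/
theorem scalarMeasure_cyclicIsometry (hx : E.scalarMeasure x = ν) (f : Lp ℂ 2 ν) :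
    E.scalarMeasure (cyclicIsometry hx f) = ν.withDensity fun t => ‖f t‖ₑ ^ 2 := by
  ext Δ hΔ
  rw [E.scalarMeasure_apply hΔ, proj_cyclicIsometry hx f hΔ, LinearIsometry.norm_map,
    norm_sq_lp_two, withDensity_apply _ hΔ, ← lintegral_indicator hΔ]
  refine lintegral_congr_ae ?_
  filter_upwards [cyclicCoeff_proj hx (cyclicIsometry hx f) hΔ] with t ht
  rw [ht, cyclicCoeff_cyclicIsometry]
  by_cases h : t ∈ Δ <;> simp [h]

theorem scalarMeasure_cyclicIsometry_absolutelyContinuous (hx : E.scalarMeasure x = ν)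
    (f : Lp ℂ 2 ν) : E.scalarMeasure (cyclicIsometry hx f) ≪ ν := by
  rw [scalarMeasure_cyclicIsometry]
  exact withDensity_absolutelyContinuous _ _

/-- Every finite measure that is absolutely continuous with respect to the scalar spectral measure
of `x` is the scalar spectral measure of some `y` in the cyclic subspace of `x`, which
generates the whole part of that subspace living on the measure class. -/
theorem exists_scalarMeasure_eq_of_absolutelyContinuous {μ : Measure ℝ} [IsFiniteMeasure μ]
    (h : μ ≪ E.scalarMeasure x) :
    ∃ y, E.scalarMeasure y = μ ∧ (∀ z, E.CyclicOrth x z → E.CyclicOrth y z) ∧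
      ∀ z, E.scalarMeasure z ≪ μ → E.CyclicOrth y z → E.CyclicOrth x z := by
  set ρ := E.scalarMeasure x with hρ
  set r : ℝ → ℝ≥0∞ := μ.rnDeriv ρ with hr
  have hrm : Measurable r := Measure.measurable_rnDeriv _ _
  -- The square root of the density, since a vector f in L² has scalar measure |f|²ρ.
  set φ : ℝ → ℂ := fun t => ((Real.sqrt (r t).toReal : ℝ) : ℂ) with hφ
  have hφm : Measurable φ := by fun_prop
  have hφr : (fun t => ‖φ t‖ₑ ^ 2) =ᵐ[ρ] r := by
    filter_upwards [Measure.rnDeriv_lt_top μ ρ] with t ht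
    rw [hφ, ← ofReal_norm, Complex.norm_real, Real.norm_of_nonneg (Real.sqrt_nonneg _),
      ← ENNReal.ofReal_pow (Real.sqrt_nonneg _), Real.sq_sqrt ENNReal.toReal_nonneg,
      ENNReal.ofReal_toReal ht.ne]
  have hφL : MemLp φ 2 ρ := by
    refine ⟨hφm.aestronglyMeasurable, ?_⟩
    have h1 := eLpNorm_nnreal_pow_eq_lintegral (f := φ) (μ := ρ) (p := 2) (by norm_num)
    have h2 : ∫⁻ t, ‖φ t‖ₑ ^ ((2 : NNReal) : ℝ) ∂ρ < ∞ := by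
      have h3 : ∫⁻ t, ‖φ t‖ₑ ^ ((2 : NNReal) : ℝ) ∂ρ = ∫⁻ t, r t ∂ρ := by
        refine lintegral_congr_ae ?_
        filter_upwards [hφr] with t ht
        simpa using ht
      rw [h3]
      exact (Measure.lintegral_rnDeriv_le).trans_lt (measure_lt_top μ _)
    rw [← h1] at h2
    by_contra h4
    rw [not_lt, top_le_iff] at h4
    have h5 : eLpNorm φ ((2 : NNReal) : ℝ≥0∞) ρ = ∞ := by simpa using h4
    rw [h5] at h2
    simp at h2
  set f : Lp ℂ 2 ρ := hφL.toLp φ with hf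
  have hfφ : f =ᵐ[ρ] φ := hφL.coeFn_toLp
  have hx : E.scalarMeasure x = ρ := rfl
  refine ⟨cyclicIsometry hx f, ?_, fun z hz => hz.cyclicIsometry hx f, fun z hz hyz => ?_⟩
  · rw [scalarMeasure_cyclicIsometry, ← Measure.withDensity_rnDeriv_eq _ _ h]
    refine withDensity_congr_ae ?_
    filter_upwards [hfφ, hφr] with t h1 h2
    rw [h1, h2]
  · rw [← cyclicCoeff_eq_zero_iff hx, Lp.eq_zero_iff_ae_eq_zero]
    set g := cyclicCoeff hx z with hg
    -- Orthogonality to y says that the product of g with the conjugate of f vanishes almost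
    -- everywhere.
    have h1 : (fun t => ⟪f t, g t⟫_ℂ) =ᵐ[ρ] 0 := by
      refine (L2.integrable_inner f g).ae_eq_zero_of_forall_setIntegral_eq_zero fun s hs _ => ?_
      have h2 := hyz s hs
      rw [← inner_cyclicCoeff, L2.inner_def] at h2
      rw [← h2, ← integral_indicator hs]
      refine integral_congr_ae ?_
      filter_upwards [cyclicCoeff_proj hx z hs] with t ht
      rw [ht]
      by_cases hts : t ∈ s <;> simp [hts, hg]
    -- Where f vanishes the product carries no information about g; but N is null for μ, hence for
    -- z, so g vanishes on N as well.
    set N := {t | r t = 0} with hN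
    have hNm : MeasurableSet N := hrm (measurableSet_singleton 0)
    have h3 : μ N = 0 := by
      rw [← Measure.withDensity_rnDeriv_eq _ _ h, withDensity_apply _ hNm]
      exact setLIntegral_eq_zero hNm fun t ht => ht
    have h4 : E.proj N z = 0 := (E.scalarMeasure_absolutelyContinuous_iff.1 hz) N hNm h3
    have h5 := cyclicCoeff_proj hx z hNm
    rw [h4, (cyclicCoeff_eq_zero_iff hx).2 fun Δ _ => by simp] at h5
    filter_upwards [h1, h5, Lp.coeFn_zero ℂ 2 ρ, hfφ, hφr] with t ht1 ht2 ht3 ht4 ht5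
    by_cases htN : t ∈ N
    · rw [ht3, indicator_of_mem htN] at ht2
      exact ht2.symm
    · have h6 : f t ≠ 0 := by
        rw [ht4]
        intro h7
        rw [h7] at ht5
        exact htN (show r t = 0 by simpa using ht5.symm)
      simpa [h6] using ht1

/-- The two coefficients are complex conjugates of each other, because ⟪x, E(Δ)y⟫ and ⟪y, E(Δ)x⟫
are. This symmetry drives the double count in `IsCompleteFamily.mk_le_of_eq`. -/
theorem norm_cyclicCoeff_comm {y : H} (hx : E.scalarMeasure x = ν) (hy : E.scalarMeasure y = ν) :
    ‖cyclicCoeff hx y‖ = ‖cyclicCoeff hy x‖ := by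
  have h : cyclicCoeff hx y =ᵐ[ν] fun t => starRingEnd ℂ (cyclicCoeff hy x t) := by
    refine cyclicCoeff_ae_eq hx y ?_ fun Δ hΔ => ?_
    · exact (integrable_coe_lp_two (cyclicCoeff hy x)).congr' (by
        exact (Complex.continuous_conj.comp_aestronglyMeasurable
          (Lp.aestronglyMeasurable (cyclicCoeff hy x)))) (by simp)
    · rw [integral_conj, setIntegral_cyclicCoeff hy x hΔ, inner_conj_symm, E.inner_proj_left hΔ]
  rw [Lp.norm_def, Lp.norm_def]
  congr 1
  refine eLpNorm_congr_norm_ae ?_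
  filter_upwards [h] with t ht
  rw [ht, RCLike.norm_conj]

theorem orthogonalFamily_cyclicIsometry {ι : Type*} {y : ι → H}
    (hy : ∀ i, E.scalarMeasure (y i) = ν) (ho : Pairwise fun i j => E.CyclicOrth (y i) (y j)) :
    OrthogonalFamily ℂ (fun _ : ι => Lp ℂ 2 ν) fun i => cyclicIsometry (hy i) :=
  fun i j hij f g => (((ho hij).cyclicIsometry (hy i) f).symm.cyclicIsometry
    (hy j) g).symm.inner_eq_zero

theorem inner_sum_cyclicIsometry {ι : Type*} {y : ι → H}
    (hy : ∀ i, E.scalarMeasure (y i) = ν) (z : H) (s : Finset ι) :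
    ⟪∑ i ∈ s, cyclicIsometry (hy i) (cyclicCoeff (hy i) z), z⟫_ℂ =
      ((∑ i ∈ s, ‖cyclicCoeff (hy i) z‖ ^ 2 : ℝ) : ℂ) := by
  rw [sum_inner]
  push_cast
  refine Finset.sum_congr rfl fun i _ => ?_
  rw [← inner_cyclicCoeff, inner_self_eq_norm_sq_to_K]
  rfl

/-- Bessel's inequality for orthogonal cyclic subspaces. -/
theorem sum_norm_cyclicCoeff_le {ι : Type*} {y : ι → H} (hy : ∀ i, E.scalarMeasure (y i) = ν)
    (ho : Pairwise fun i j => E.CyclicOrth (y i) (y j)) (z : H) (s : Finset ι) :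
    ∑ i ∈ s, ‖cyclicCoeff (hy i) z‖ ^ 2 ≤ ‖z‖ ^ 2 := by
  set S := ∑ i ∈ s, ‖cyclicCoeff (hy i) z‖ ^ 2 with hS
  set w := ∑ i ∈ s, cyclicIsometry (hy i) (cyclicCoeff (hy i) z) with hw
  have h1 : ‖w‖ ^ 2 = S := (orthogonalFamily_cyclicIsometry hy ho).norm_sum _ s
  have h2 : S ≤ ‖w‖ * ‖z‖ := by
    have h3 := norm_inner_le_norm (𝕜 := ℂ) w z
    rw [hw, inner_sum_cyclicIsometry hy z s, ← hS, ← hw, Complex.norm_real] at h3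
    exact (le_abs_self S).trans h3
  nlinarith [sq_nonneg (‖w‖ - ‖z‖), norm_nonneg w, norm_nonneg z]

end CyclicIsometry

end SpectralMeasure

namespace SpectralMeasure

variable {H : Type u} [NormedAddCommGroup H] [InnerProductSpace ℂ H] [CompleteSpace H]
variable {K : Type v} [NormedAddCommGroup K] [InnerProductSpace ℂ K] [CompleteSpace K]
variable {E : SpectralMeasure H} {F : SpectralMeasure K}

-- Integrals against a spectral measure and uniqueness of the spectral measure

section Integral

theorem scalarMeasure_map (U : H ≃ₗᵢ[ℂ] K)
    (hU : ∀ Δ, MeasurableSet Δ → ∀ h, U (E.proj Δ h) = F.proj Δ (U h)) (h : H) :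
    F.scalarMeasure (U h) = E.scalarMeasure h := by
  ext Δ hΔ
  rw [E.scalarMeasure_apply hΔ, F.scalarMeasure_apply hΔ, ← hU Δ hΔ, LinearIsometryEquiv.norm_map]

/-- A unitary that intertwines spectral measures intertwines integrals. -/
theorem HasIntegral.map_apply {φ : ℝ → ℝ} {T : H →L[ℂ] H} {S : K →L[ℂ] K}
    (hT : E.HasIntegral φ T) (hS : F.HasIntegral φ S) (U : H ≃ₗᵢ[ℂ] K)
    (hU : ∀ Δ, MeasurableSet Δ → ∀ h, U (E.proj Δ h) = F.proj Δ (U h)) (h : H) :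
    U (T h) = S (U h) := by
  have h1 : T = (U.symm.toContinuousLinearEquiv : K →L[ℂ] H) ∘L S ∘L
      (U.toContinuousLinearEquiv : H →L[ℂ] K) := by
    refine continuousLinearMap_eq_of_inner_self fun x => ?_
    rw [(hT x).2, ← scalarMeasure_map U hU, ← (hS (U x)).2, ← U.inner_map_map]
    simp
  have h2 := congrArg (fun T : H →L[ℂ] H => U (T h)) h1
  simpa using h2

theorem HasIntegral.isSymmetric {φ : ℝ → ℝ} {T : H →L[ℂ] H} (hT : E.HasIntegral φ T) :
    T.toLinearMap.IsSymmetric := by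
  rw [LinearMap.isSymmetric_iff_inner_map_self_real]
  intro x
  have h1 : ⟪T.toLinearMap x, x⟫_ℂ = _ := (inner_conj_symm _ _).symm
  rw [h1]
  simp only [ContinuousLinearMap.coe_coe, (hT x).2, Complex.conj_ofReal]

/-- Kernels invariant under a spectral measure are invariant under its integrals. -/
theorem HasIntegral.map_ker {φ : ℝ → ℝ} {T : H →L[ℂ] H} (hT : E.HasIntegral φ T)
    (Q : H →L[ℂ] H) (hQ : ∀ Δ, MeasurableSet Δ → ∀ v, Q v = 0 → Q (E.proj Δ v) = 0)
    {v : H} (hv : Q v = 0) : Q (T v) = 0 := by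
  set V : Submodule ℂ H := LinearMap.ker Q.toLinearMap with hV
  have hVc : IsClosed (V : Set H) := Q.isClosed_ker
  have : CompleteSpace V := hVc.completeSpace_coe
  have hmem : ∀ {w}, w ∈ V ↔ Q w = 0 := Iff.rfl
  have hVo : ∀ Δ, MeasurableSet Δ → ∀ w ∈ Vᗮ, E.proj Δ w ∈ Vᗮ := by
    intro Δ hΔ w hw u hu
    rw [← E.inner_proj_left hΔ]
    exact hw _ (hQ Δ hΔ u hu)
  -- The kernel V reduces E, so the reflection in V is a unitary commuting with E. By
  -- `HasIntegral.map_apply` it commutes with T, and hence T preserves its fixed space V.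
  have hR : ∀ Δ, MeasurableSet Δ → ∀ h,
      V.reflection (E.proj Δ h) = E.proj Δ (V.reflection h) := by
    intro Δ hΔ h
    obtain ⟨a, ha, b, hb, rfl⟩ := V.exists_add_mem_mem_orthogonal h
    simp only [map_add]
    rw [Submodule.reflection_mem_subspace_eq_self ha,
      Submodule.reflection_mem_subspace_eq_self (K := V) (hQ Δ hΔ a ha),
      Submodule.reflection_mem_subspace_orthogonalComplement_eq_neg hb,
      Submodule.reflection_mem_subspace_orthogonalComplement_eq_neg (hVo Δ hΔ b hb), map_neg]
  have h1 := hT.map_apply hT V.reflection hR v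
  rw [Submodule.reflection_mem_subspace_eq_self (K := V) hv, Submodule.reflection_eq_self_iff] at h1
  exact h1

/-- The kernels of E(Δ) and E(Δᶜ) are invariant under E, hence under T, so T respects the splitting
they define. -/
theorem HasIntegral.proj_apply {φ : ℝ → ℝ} {T : H →L[ℂ] H} (hT : E.HasIntegral φ T)
    {Δ : Set ℝ} (hΔ : MeasurableSet Δ) (h : H) : E.proj Δ (T h) = T (E.proj Δ h) := by
  have h1 : E.proj Δᶜ (T (E.proj Δ h)) = 0 := by
    refine hT.map_ker (E.proj Δᶜ) (fun s hs v hv => ?_)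
      (E.proj_proj_of_disjoint hΔ.compl hΔ disjoint_compl_left h)
    rw [E.proj_comm hΔ.compl hs, hv, map_zero]
  have h2 : E.proj Δ (T (E.proj Δᶜ h)) = 0 := by
    refine hT.map_ker (E.proj Δ) (fun s hs v hv => ?_)
      (E.proj_proj_of_disjoint hΔ hΔ.compl disjoint_compl_right h)
    rw [E.proj_comm hΔ hs, hv, map_zero]
  conv_lhs => rw [← E.proj_add_proj_compl hΔ h, map_add, map_add, h2, add_zero]
  exact E.proj_eq_self_of_compl hΔ h1

/-- Under the isomorphism of `L²` with the cyclic subspace of `h`, the vector `(∫ φ dE) h`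
corresponds to `φ`. -/
theorem HasIntegral.cyclicIsometry {φ : ℝ → ℝ} {T : H →L[ℂ] H} (hT : E.HasIntegral φ T) (h : H) :
    T h = SpectralMeasure.cyclicIsometry (E := E) (x := h) rfl (cyclicCoeff rfl (T h)) ∧
      cyclicCoeff (E := E) (x := h) rfl (T h) =ᵐ[E.scalarMeasure h] fun t => (φ t : ℂ) := by
  constructor
  · set V := (SpectralMeasure.cyclicIsometry (E := E) (x := h) rfl).toContinuousLinearMap with hV
    obtain ⟨f, hf⟩ : ∃ f, V f = h :=
      ⟨_, (cyclicIsometry_indicator (E := E) (x := h) rfl .univ).trans (by rw [E.proj_univ]; rfl)⟩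
    have hVV : ∀ f, ContinuousLinearMap.adjoint V (V f) = f := cyclicCoeff_cyclicIsometry _
    -- The kernel of 1 − VV* is the cyclic subspace of h; it contains h and is invariant under E, so
    -- it contains Th.
    have h2 : (1 - V ∘L ContinuousLinearMap.adjoint V) (T h) = 0 := by
      refine hT.map_ker _ (fun Δ hΔ v hv => ?_) ?_
      · simp only [sub_apply, one_apply_eq_self,
          ContinuousLinearMap.comp_apply, sub_eq_zero] at hv ⊢
        rw [hv]
        exact proj_cyclicIsometry rfl _ hΔ
      · simp only [sub_apply, one_apply_eq_self,
          ContinuousLinearMap.comp_apply, sub_eq_zero]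
        have h3 := hVV f
        rw [hf] at h3
        rw [h3, hf]
    exact sub_eq_zero.1 h2
  · refine cyclicCoeff_ae_eq rfl _ (hT h).1.ofReal fun Δ hΔ => ?_
    rw [← E.inner_proj_left hΔ, ← E.proj_proj_self hΔ, E.inner_proj_left hΔ, hT.proj_apply hΔ,
      (hT _).2, E.scalarMeasure_proj hΔ, integral_complex_ofReal]

/-- By symmetry ⟪h, TSh⟫ = ⟪Th, Sh⟫, which in the cyclic subspace of h is the L² inner product of φ
and ψ. Integrability of the product comes from φ and ψ being square integrable there. -/
theorem HasIntegral.mul {φ ψ : ℝ → ℝ} {T S : H →L[ℂ] H} (hT : E.HasIntegral φ T)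
    (hS : E.HasIntegral ψ S) : E.HasIntegral (fun t => φ t * ψ t) (T * S) := by
  intro h
  obtain ⟨hT1, hT2⟩ := hT.cyclicIsometry h
  obtain ⟨hS1, hS2⟩ := hS.cyclicIsometry h
  have h1 : (fun t => ⟪cyclicCoeff (E := E) (x := h) rfl (T h) t,
      cyclicCoeff (E := E) (x := h) rfl (S h) t⟫_ℂ) =ᵐ[E.scalarMeasure h]
      fun t => ((φ t * ψ t : ℝ) : ℂ) := by
    filter_upwards [hT2, hS2] with t h2 h3
    rw [h2, h3]
    simp [mul_comm]
  have h2 := (L2.integrable_inner (𝕜 := ℂ) (cyclicCoeff (E := E) (x := h) rfl (T h))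
    (cyclicCoeff (E := E) (x := h) rfl (S h))).congr h1
  refine ⟨by simpa using h2.re, ?_⟩
  have h3 : ⟪h, (T * S) h⟫_ℂ = ⟪T h, S h⟫_ℂ := (hT.isSymmetric h (S h)).symm
  rw [h3, hT1, hS1, LinearIsometry.inner_map_map, L2.inner_def, integral_congr_ae h1,
    integral_complex_ofReal]

theorem hasIntegral_one : E.HasIntegral (fun _ => 1) 1 := by
  intro h
  refine ⟨integrable_const _, ?_⟩
  have := E.inner_proj_self_eq_real .univ h
  rw [E.proj_univ] at this
  rw [this, measureReal_def]
  simp [measureReal_def]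

theorem HasIntegral.pow {T : H →L[ℂ] H} (hT : E.HasIntegral (fun x => x) T) (n : ℕ) :
    E.HasIntegral (fun x => x ^ n) (T ^ n) := by
  induction n with
  | zero => simpa using hasIntegral_one
  | succ n ih => simpa only [pow_succ] using ih.mul hT

theorem scalarMeasure_compl_eq_zero {C D : Set ℝ} (hC : IsCompact C) (hE : E.proj C = 1)
    (hD : MeasurableSet D) (hCD : C ⊆ D) (h : H) : E.scalarMeasure h Dᶜ = 0 := by
  rw [E.scalarMeasure_eq_zero_iff hD.compl]
  have h1 := E.proj_proj_of_disjoint hD.compl hC.measurableSet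
    (disjoint_compl_left.mono_right hCD) h
  rwa [hE] at h1

/-- The moments of both scalar measures are the numbers ⟪h, Aⁿh⟫, which depend on A only. -/
theorem eval_integral_eq {E F : SpectralMeasure H} {A : H →L[ℂ] H}
    (hE : E.HasIntegral (fun x => x) A) (hF : F.HasIntegral (fun x => x) A) (h : H)
    (p : Polynomial ℝ) : Integrable (fun t => p.eval t) (E.scalarMeasure h) ∧
      Integrable (fun t => p.eval t) (F.scalarMeasure h) ∧
      ∫ t, p.eval t ∂(E.scalarMeasure h) = ∫ t, p.eval t ∂(F.scalarMeasure h) := by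
  induction p using Polynomial.induction_on' with
  | add p q hp hq =>
    simp only [Polynomial.eval_add]
    refine ⟨hp.1.add hq.1, hp.2.1.add hq.2.1, ?_⟩
    rw [integral_add hp.1 hq.1, integral_add hp.2.1 hq.2.1, hp.2.2, hq.2.2]
  | monomial n a =>
    simp only [Polynomial.eval_monomial]
    refine ⟨((hE.pow n) h).1.const_mul a, ((hF.pow n) h).1.const_mul a, ?_⟩
    rw [integral_const_mul, integral_const_mul]
    congr 1
    have := (((hE.pow n) h).2).symm.trans ((hF.pow n) h).2
    exact_mod_cast this

/-- The spectral measure of a bounded selfadjoint operator is unique. -/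
theorem IsSpectralMeasureOf.proj_eq {E F : SpectralMeasure H} {A : H →L[ℂ] H}
    (hE : E.IsSpectralMeasureOf A) (hF : F.IsSpectralMeasureOf A) {Δ : Set ℝ}
    (hΔ : MeasurableSet Δ) : E.proj Δ = F.proj Δ := by
  obtain ⟨⟨C, hC, -, hC1⟩, hEA⟩ := hE
  obtain ⟨⟨C', hC', -, hC1'⟩, hFA⟩ := hF
  obtain ⟨R, hR⟩ := (hC.union hC').isBounded.subset_closedBall 0
  rw [Real.closedBall_eq_Icc] at hR
  set I := Icc (0 - R) (0 + R) with hI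
  have hCI : C ⊆ I := subset_union_left.trans hR
  have hCI' : C' ⊆ I := subset_union_right.trans hR
  have key : ∀ h, E.scalarMeasure h = F.scalarMeasure h := by
    intro h
    have h1 : ∀ᵐ t ∂(E.scalarMeasure h), t ∈ I :=
      mem_ae_iff.2 (scalarMeasure_compl_eq_zero hC hC1 measurableSet_Icc hCI h)
    have h2 : ∀ᵐ t ∂(F.scalarMeasure h), t ∈ I :=
      mem_ae_iff.2 (scalarMeasure_compl_eq_zero hC' hC1' measurableSet_Icc hCI' h)
    have hmass : (E.scalarMeasure h).real univ = (F.scalarMeasure h).real univ := by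
      rw [measureReal_def, measureReal_def, E.scalarMeasure_univ, F.scalarMeasure_univ]
    refine ext_of_forall_integral_eq_of_IsFiniteMeasure fun f => ?_
    refine eq_of_abs_sub_le_all fun ε hε => ?_
    set m := (F.scalarMeasure h).real univ with hm
    have hm0 : 0 ≤ m := measureReal_nonneg
    -- Both measures have mass m, so this tolerance costs at most ε/2 on each side; the summand 1
    -- covers m = 0.
    obtain ⟨p, hp⟩ := exists_polynomial_near_of_continuousOn (0 - R) (0 + R) f
      f.continuous.continuousOn (ε / (2 * (m + 1))) (by positivity)
    obtain ⟨hi1, hi2, hi3⟩ := eval_integral_eq hEA hFA h p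
    have hest : ∀ (μ : Measure ℝ) [IsFiniteMeasure μ], Integrable (fun t => p.eval t) μ →
        (∀ᵐ t ∂μ, t ∈ I) → μ.real univ = m →
        |∫ t, f t ∂μ - ∫ t, p.eval t ∂μ| ≤ ε / 2 := by
      intro μ _ hi hμ hμm
      rw [← integral_sub (f.integrable μ) hi]
      have h3 := norm_integral_le_of_norm_le_const (μ := μ) (f := fun t => f t - p.eval t)
        (C := ε / (2 * (m + 1))) (by
          filter_upwards [hμ] with t ht
          rw [Real.norm_eq_abs, abs_sub_comm]
          exact (hp t ht).le)
      rw [hμm, Real.norm_eq_abs] at h3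
      refine h3.trans ?_
      rw [div_mul_eq_mul_div, div_le_div_iff₀ (by positivity) (by positivity)]
      nlinarith
    have h3 := hest _ hi1 h1 hmass
    have h4 := hest _ hi2 h2 rfl
    rw [hi3] at h3
    rw [abs_le] at h3 h4 ⊢
    constructor <;> linarith [h3.1, h3.2, h4.1, h4.2]
  refine continuousLinearMap_eq_of_inner_self fun h => ?_
  rw [E.inner_proj_self_eq_real hΔ, F.inner_proj_self_eq_real hΔ, key]

end Integral

end SpectralMeasure

/-- Zorn's lemma. Maximality is phrased as membership: in the applications a new element related to
all of s then becomes related to itself, which forces it to be zero. -/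
theorem exists_maximal_pairwise {α : Type*} (P : α → Prop) (R : α → α → Prop) :
    ∃ s : Set α, (∀ x ∈ s, P x) ∧ s.Pairwise R ∧
      ∀ a, P a → (∀ x ∈ s, R a x ∧ R x a) → a ∈ s := by
  obtain ⟨s, hs⟩ := zorn_subset {s : Set α | (∀ x ∈ s, P x) ∧ s.Pairwise R} fun c hc hch =>
    ⟨⋃₀ c, ⟨fun x ⟨t, ht, hx⟩ => (hc ht).1 x hx,
      (pairwise_sUnion hch.directedOn).2 fun t ht => (hc ht).2⟩,
      fun t ht => subset_sUnion_of_mem ht⟩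
  refine ⟨s, hs.prop.1, hs.prop.2, fun a ha hR => ?_⟩
  have h1 : insert a s ⊆ s := hs.le_of_ge ⟨?_, ?_⟩ (subset_insert a s)
  · exact h1 (mem_insert a s)
  · rintro x (rfl | hx)
    · exact ha
    · exact hs.prop.1 x hx
  · exact hs.prop.2.insert fun b hb _ => hR b hb

-- Exhaustion and restriction of finite measures

section Measure

/-- A class of measurable sets closed under countable unions has an essentially largest element. -/
theorem exists_essentially_largest {ν : Measure ℝ} [IsFiniteMeasure ν] (R : Set ℝ → Prop)
    (h0 : R ∅) (hU : ∀ s : ℕ → Set ℝ, (∀ n, R (s n)) → R (⋃ n, s n)) :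
    ∃ Δ, R Δ ∧ ∀ Δ', R Δ' → MeasurableSet Δ' → Disjoint Δ' Δ → ν Δ' = 0 := by
  -- The union of a maximizing sequence attains the supremum of ν over the class; a disjoint member
  -- of positive measure would exceed it.
  obtain ⟨u, -, hu, hu'⟩ := exists_seq_tendsto_sSup (S := {a | ∃ Δ, R Δ ∧ ν Δ = a})
    ⟨_, ∅, h0, rfl⟩ (OrderTop.bddAbove _)
  choose s hs hsu using hu'
  refine ⟨⋃ n, s n, hU s hs, fun Δ' hΔ' hm hd => ?_⟩
  have h1 : sSup {a | ∃ Δ, R Δ ∧ ν Δ = a} ≤ ν (⋃ n, s n) :=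
    le_of_tendsto' hu fun n => hsu n ▸ measure_mono (subset_iUnion s n)
  have h2 : R (Δ' ∪ ⋃ n, s n) := by
    have := hU (fun n => n.casesOn Δ' s) (fun n => by cases n <;> simp [hΔ', hs])
    have h3 : (⋃ n : ℕ, (n.casesOn Δ' s : Set ℝ)) = Δ' ∪ ⋃ n, s n := by
      ext t
      simp only [mem_iUnion, mem_union]
      constructor
      · rintro ⟨n, hn⟩
        cases n with
        | zero => exact Or.inl hn
        | succ n => exact Or.inr ⟨n, hn⟩
      · rintro (h | ⟨n, hn⟩)
        · exact ⟨0, h⟩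
        · exact ⟨n + 1, hn⟩
    rwa [h3] at this
  have h3 : ν (Δ' ∪ ⋃ n, s n) ≤ ν (⋃ n, s n) := (le_sSup (s := {a | ∃ Δ, R Δ ∧ ν Δ = a}) ⟨_, h2, rfl⟩).trans h1
  rw [measure_union' hd hm] at h3
  have h4 : ν Δ' + ν (⋃ n, s n) ≤ 0 + ν (⋃ n, s n) := by rwa [zero_add]
  exact le_antisymm (ENNReal.le_of_add_le_add_right (measure_ne_top _ _) h4) bot_le

/-- For D take the set where the density of ρ does not vanish. -/
theorem exists_restrict_absolutelyContinuous {ρ ν : Measure ℝ} [IsFiniteMeasure ρ]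
    [IsFiniteMeasure ν] (h : ρ ≪ ν) :
    ∃ D, MeasurableSet D ∧ ρ ≪ ν.restrict D ∧ ν.restrict D ≪ ρ := by
  have hm := Measure.measurable_rnDeriv ρ ν
  have hN : MeasurableSet {t | ρ.rnDeriv ν t = 0} := hm (measurableSet_singleton 0)
  have hs : ∀ s, MeasurableSet s → ρ s = ∫⁻ t in s, ρ.rnDeriv ν t ∂ν := fun s hs => by
    rw [Measure.setLIntegral_rnDeriv h]
  refine ⟨{t | ρ.rnDeriv ν t = 0}ᶜ, hN.compl, Measure.AbsolutelyContinuous.mk fun s hms h0 => ?_,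
    Measure.AbsolutelyContinuous.mk fun s hms h0 => ?_⟩
  · rw [Measure.restrict_apply hms] at h0
    have h1 : ρ {t | ρ.rnDeriv ν t = 0} = 0 := by
      rw [hs _ hN]
      exact setLIntegral_eq_zero hN fun t ht => ht
    refine measure_mono_null (t := (s ∩ {t | ρ.rnDeriv ν t = 0}ᶜ) ∪ {t | ρ.rnDeriv ν t = 0}) ?_
      (measure_union_null (h h0) h1)
    intro t ht
    by_cases h2 : ρ.rnDeriv ν t = 0
    · exact Or.inr h2
    · exact Or.inl ⟨ht, h2⟩
  · rw [hs s hms, lintegral_eq_zero_iff hm] at h0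
    rw [Measure.restrict_apply hms]
    rw [Filter.EventuallyEq, ae_iff, Measure.restrict_apply' hms] at h0
    refine measure_mono_null ?_ h0
    rintro t ⟨ht, h2⟩
    exact ⟨h2, ht⟩

end Measure

-- Complete families and the multiplicity of a measure

namespace SpectralMeasure

variable {H : Type u} [NormedAddCommGroup H] [InnerProductSpace ℂ H] [CompleteSpace H]
variable {K : Type v} [NormedAddCommGroup K] [InnerProductSpace ℂ K] [CompleteSpace K]
variable (E : SpectralMeasure H) {F : SpectralMeasure K} {ν : Measure ℝ}

/-- Vectors living on disjoint Borel sets can be added up. -/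
theorem exists_hasSum_of_disjoint {D : ℕ → Set ℝ} (hD : ∀ n, MeasurableSet (D n))
    (hd : Pairwise fun i j => Disjoint (D i) (D j)) {u : ℕ → H}
    (hu : ∀ n, E.proj (D n) (u n) = u n) (hν : ∀ n, E.scalarMeasure (u n) = ν.restrict (D n))
    [IsFiniteMeasure ν] :
    ∃ z, HasSum u z ∧ (∀ n, E.proj (D n) z = u n) ∧ E.scalarMeasure z = ν.restrict (⋃ n, D n) := by
  let V : ℕ → Submodule ℂ H := fun n => LinearMap.range (E.proj (D n)).toLinearMap
  have hV : OrthogonalFamily ℂ (fun n => V n) fun n => (V n).subtypeₗᵢ := by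
    rintro i j hij ⟨_, x, rfl⟩ ⟨_, y, rfl⟩
    exact (cyclicOrth_proj_proj_of_disjoint (hD i) (hD j) (hd hij) x y).inner_eq_zero
  -- The squared norms are the masses ν(D n), with finite sum by disjointness.
  have hs : Summable fun n => ‖u n‖ ^ 2 := by
    have h1 : ∀ n, ν.real (D n) = ‖u n‖ ^ 2 := fun n => by
      have h2 := E.scalarMeasure_real (hD n) (u n)
      rw [hν, hu, measureReal_restrict_apply (hD n), inter_self] at h2
      exact h2
    simp_rw [← h1]
    have h3 : ∑' n, ν (D n) ≠ ∞ := by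
      rw [← measure_iUnion hd hD]
      exact measure_ne_top _ _
    exact ENNReal.summable_toReal h3
  have hsum : Summable u :=
    (hV.summable_iff_norm_sq_summable fun n => ⟨u n, ⟨u n, hu n⟩⟩).2 hs
  obtain ⟨z, hz⟩ := hsum
  have h1 : ∀ n, E.proj (D n) z = u n := fun n => by
    have h2 := (E.proj (D n)).hasSum hz
    refine h2.unique ?_
    have h3 : ∀ m, m ≠ n → E.proj (D n) (u m) = 0 := fun m hm => by
      rw [← hu m, E.proj_proj_of_disjoint (hD n) (hD m) (hd hm.symm)]
    have h4 := hasSum_single (f := fun m => E.proj (D n) (u m)) n h3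
    simpa [hu] using h4
  have hDm : MeasurableSet (⋃ n, D n) := .iUnion hD
  have h2 : E.proj (⋃ n, D n) z = z := by
    refine ((E.proj (⋃ n, D n)).hasSum hz).unique ?_
    convert hz using 2 with n
    rw [← hu n, E.proj_proj hDm (hD n), inter_eq_right.2 (subset_iUnion D n)]
  refine ⟨z, hz, h1, ?_⟩
  rw [← h2, E.scalarMeasure_proj hDm, Measure.restrict_iUnion hd hD, Measure.restrict_iUnion hd hD]
  congr 1
  funext n
  rw [← E.scalarMeasure_proj (hD n), h1, hν]

/-- The Lebesgue decomposition of the vector `z` with respect to `ν`. -/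
theorem exists_proj_absolutelyContinuous [IsFiniteMeasure ν] (z : H) :
    ∃ N, MeasurableSet N ∧ E.scalarMeasure (E.proj N z) ≪ ν ∧ ν Nᶜ = 0 := by
  obtain ⟨N, hN, h1, h2⟩ := (Measure.mutuallySingular_singularPart (E.scalarMeasure z) ν)
  refine ⟨N, hN, ?_, h2⟩
  rw [E.scalarMeasure_proj hN]
  have h4 := (Measure.haveLebesgueDecomposition_spec (E.scalarMeasure z) ν).2.2
  refine Measure.AbsolutelyContinuous.mk fun s hs hs0 => ?_
  rw [Measure.restrict_apply hs, h4, Measure.add_apply,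
    measure_mono_null inter_subset_right h1, zero_add]
  exact measure_mono_null inter_subset_left (withDensity_absolutelyContinuous ν _ hs0)

section Multiplicity

/-- The family `x` exhibits the part of `E` living on the class of `ν` as a multiple of
multiplication by the coordinate on `L²(ν)`. -/
def IsCompleteFamily (ν : Measure ℝ) {ι : Type*} (x : ι → H) : Prop :=
  (∀ i, E.scalarMeasure (x i) = ν) ∧ (Pairwise fun i j => E.CyclicOrth (x i) (x j)) ∧
    ∀ z, E.scalarMeasure z ≪ ν → (∀ i, E.CyclicOrth (x i) z) → z = 0

variable {E}

/-- Inside each cyclic subspace choose a vector with measure ν' that generates the whole part on the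
class of ν'; completeness is inherited and the index set is kept. -/
theorem IsCompleteFamily.exists_of_absolutelyContinuous {ι : Type*} {x : ι → H}
    (hx : E.IsCompleteFamily ν x) {ν' : Measure ℝ} [IsFiniteMeasure ν'] (h : ν' ≪ ν) :
    ∃ x' : ι → H, E.IsCompleteFamily ν' x' := by
  have h1 : ∀ i, ν' ≪ E.scalarMeasure (x i) := fun i => by rwa [hx.1 i]
  choose x' hx' ho hc using fun i => exists_scalarMeasure_eq_of_absolutelyContinuous (h1 i)
  refine ⟨x', hx', fun i j hij => ?_, fun z hz hzo => ?_⟩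
  · exact ho i _ (ho j _ (hx.2.1 hij.symm)).symm
  · exact hx.2.2 z (hz.trans h) fun i => hc i z hz (hzo i)

theorem norm_sq_of_scalarMeasure_eq {x : H} (hx : E.scalarMeasure x = ν) :
    ‖x‖ ^ 2 = ν.real univ := by
  rw [measureReal_def, ← hx, E.scalarMeasure_univ, ENNReal.toReal_ofReal (by positivity)]

/-- Parseval: the remainder of y after projecting onto the cyclic subspaces still lives on the class
of ν and is orthogonal to the family, so completeness annihilates it. -/
theorem IsCompleteFamily.norm_sq_eq_sum [IsFiniteMeasure ν] {ι : Type*} [Fintype ι] {x : ι → H}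
    (hx : E.IsCompleteFamily ν x) {y : H} (hy : E.scalarMeasure y ≪ ν) :
    ‖y‖ ^ 2 = ∑ i, ‖cyclicCoeff (hx.1 i) y‖ ^ 2 := by
  set w := ∑ i, cyclicIsometry (hx.1 i) (cyclicCoeff (hx.1 i) y) with hw
  have hyw : y - w = 0 := by
    refine hx.2.2 _ ?_ fun i => ?_
    · rw [E.scalarMeasure_absolutelyContinuous_iff] at hy ⊢
      intro Δ hΔ h0
      rw [map_sub, hy Δ hΔ h0, hw, map_sum, Finset.sum_eq_zero, sub_zero]
      intro i _
      exact E.scalarMeasure_absolutelyContinuous_iff.1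
        (scalarMeasure_cyclicIsometry_absolutelyContinuous _ _) Δ hΔ h0
    · classical
      have h1 : y - w = (y - cyclicIsometry (hx.1 i) (cyclicCoeff (hx.1 i) y)) -
          ∑ j ∈ Finset.univ.erase i, cyclicIsometry (hx.1 j) (cyclicCoeff (hx.1 j) y) := by
        rw [hw, ← Finset.add_sum_erase _ _ (Finset.mem_univ i)]
        abel
      intro Δ hΔ
      rw [h1, map_sub, inner_sub_right, cyclicOrth_sub_cyclicIsometry (hx.1 i) y Δ hΔ, map_sum,
        inner_sum, Finset.sum_eq_zero, sub_zero]
      intro j hj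
      exact ((hx.2.1 (Finset.ne_of_mem_erase hj)).cyclicIsometry (hx.1 j) _).symm Δ hΔ
  have h2 := inner_sum_cyclicIsometry (fun i => hx.1 i) y Finset.univ
  rw [← hw, ← sub_eq_zero.1 hyw, inner_self_eq_norm_sq_to_K] at h2
  refine Complex.ofReal_injective (Eq.trans ?_ h2)
  rw [Complex.ofReal_pow]
  rfl

/-- As for orthonormal bases. For finite ι, Parseval for the y's and Bessel for the x's bound
|t|·ν(ℝ) by |ι|·ν(ℝ) for every finite t in κ. For infinite ι, Bessel lets each x meet only countably
many y's, and completeness makes every y meet some x, so |κ| ≤ |ι|·ℵ₀ = |ι|. -/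
theorem IsCompleteFamily.mk_le_of_eq {ι κ : Type v} {x : ι → H} [IsFiniteMeasure ν]
    (hx : E.IsCompleteFamily ν x) {y : κ → H} (hy : ∀ j, E.scalarMeasure (y j) = ν)
    (ho : Pairwise fun i j => E.CyclicOrth (y i) (y j)) (h0 : ν ≠ 0) :
    Cardinal.mk κ ≤ Cardinal.mk ι := by
  have hm : 0 < ν.real univ := by
    rw [measureReal_def, ENNReal.toReal_pos_iff]
    exact ⟨by simpa [pos_iff_ne_zero] using h0, measure_lt_top _ _⟩
  have hac : ∀ j, E.scalarMeasure (y j) ≪ ν := fun j => by rw [hy j]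
  rcases finite_or_infinite ι with hι | hι
  · have := Fintype.ofFinite ι
    rw [Cardinal.mk_fintype ι]
    by_contra hlt
    rw [not_le] at hlt
    have h1 : ((Fintype.card ι + 1 : ℕ) : Cardinal) ≤ Cardinal.mk κ := by
      rw [Nat.cast_succ, ← Cardinal.succ_natCast]
      exact Order.succ_le_of_lt hlt
    obtain ⟨t, ht⟩ := Cardinal.exists_finset_eq_card h1
    have h2 : ∑ j ∈ t, ‖y j‖ ^ 2 ≤ ∑ i, ‖x i‖ ^ 2 := by
      calc ∑ j ∈ t, ‖y j‖ ^ 2 = ∑ j ∈ t, ∑ i, ‖cyclicCoeff (hx.1 i) (y j)‖ ^ 2 :=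
            Finset.sum_congr rfl fun j _ => hx.norm_sq_eq_sum (hac j)
        _ = ∑ i, ∑ j ∈ t, ‖cyclicCoeff (hy j) (x i)‖ ^ 2 := by
            rw [Finset.sum_comm]
            simp_rw [norm_cyclicCoeff_comm (hx.1 _) (hy _)]
        _ ≤ ∑ i, ‖x i‖ ^ 2 :=
            Finset.sum_le_sum fun i _ => sum_norm_cyclicCoeff_le hy ho (x i) t
    simp_rw [norm_sq_of_scalarMeasure_eq (hy _), norm_sq_of_scalarMeasure_eq (hx.1 _)] at h2
    rw [Finset.sum_const, Finset.sum_const, ← ht, Finset.card_univ, nsmul_eq_mul, nsmul_eq_mul]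
      at h2
    have h3 := le_of_mul_le_mul_right h2 hm
    push_cast at h3
    linarith
  · let S : ι → Set κ := fun i => {j | ¬ E.CyclicOrth (y j) (x i)}
    have hS : ∀ i, (S i).Countable := fun i => by
      have h1 : Summable fun j => ‖cyclicCoeff (hy j) (x i)‖ ^ 2 :=
        summable_of_sum_le (fun _ => by positivity) (sum_norm_cyclicCoeff_le hy ho (x i))
      refine h1.countable_support.mono fun j hj => ?_
      rw [Function.mem_support]
      have h2 : cyclicCoeff (hy j) (x i) ≠ 0 := fun h => hj ((cyclicCoeff_eq_zero_iff _).1 h)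
      simpa using h2
    have hU : (⋃ i, S i) = univ := by
      refine eq_univ_of_forall fun j => ?_
      by_contra hj
      simp only [S, mem_iUnion, mem_ofPred_eq, not_exists, not_not] at hj
      have h1 := hx.2.2 (y j) (hac j) fun i => (hj i).symm
      rw [← E.scalarMeasure_eq_zero, hy j] at h1
      exact h0 h1
    calc Cardinal.mk κ = Cardinal.mk (⋃ i, S i) := by rw [hU, Cardinal.mk_univ]
      _ ≤ Cardinal.mk ι * ⨆ i, Cardinal.mk (S i) := Cardinal.mk_iUnion_le S
      _ ≤ Cardinal.mk ι * Cardinal.aleph0 :=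
          mul_le_mul_right (ciSup_le' fun i => Cardinal.le_aleph0_iff_set_countable.2 (hS i)) _
      _ = Cardinal.mk ι := Cardinal.mul_aleph0_eq (Cardinal.aleph0_le_mk ι)

/-- Any family of orthogonal copies of `L²(ν')`, where `0 ≠ ν' ≪ ν`, has at most as many
members as a complete family for `ν`. -/
theorem IsCompleteFamily.mk_le {ι κ : Type v} {x : ι → H} (hx : E.IsCompleteFamily ν x)
    {ν' : Measure ℝ} [IsFiniteMeasure ν'] (h : ν' ≪ ν) (h0 : ν' ≠ 0) {y : κ → H}
    (hy : ∀ j, E.scalarMeasure (y j) = ν') (ho : Pairwise fun i j => E.CyclicOrth (y i) (y j)) :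
    Cardinal.mk κ ≤ Cardinal.mk ι := by
  obtain ⟨x', hx'⟩ := hx.exists_of_absolutelyContinuous h
  exact hx'.mk_le_of_eq hy ho h0

/-- The supremum is bounded by the cardinality comparison and attained by the range of x, which is
injective because ν ≠ 0. -/
theorem IsCompleteFamily.multiplicity_eq {ι : Type u} {x : ι → H} [IsFiniteMeasure ν]
    (hx : E.IsCompleteFamily ν x) (h0 : ν ≠ 0) : E.multiplicity ν = Cardinal.mk ι := by
  refine le_antisymm (ciSup_le' fun s => ?_) ?_
  · exact hx.mk_le_of_eq (y := fun j : s.1 => (j : H)) (fun j => s.2.2.1 j j.2)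
      (fun i j hij => s.2.2.2 i i.2 j j.2 fun h => hij (Subtype.ext h)) h0
  · have hne : ∀ i, x i ≠ 0 := fun i hi => by
      rw [← E.scalarMeasure_eq_zero, hx.1 i] at hi
      exact h0 hi
    have hinj : Function.Injective x := fun i j hij => by
      by_contra h
      have h1 := hx.2.1 h
      simp only [hij] at h1
      exact hne j h1.self_eq_zero
    have hs : E.IsMultiplicityFamily ν (range x) := by
      refine ⟨?_, ?_, ?_⟩
      · rintro _ ⟨i, rfl⟩; exact hne i
      · rintro _ ⟨i, rfl⟩; exact hx.1 i
      · rintro _ ⟨i, rfl⟩ _ ⟨j, rfl⟩ hij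
        exact hx.2.1 fun h => hij (congrArg x h)
    rw [← Cardinal.mk_range_eq x hinj]
    exact le_ciSup (f := fun s : {s : Set H // E.IsMultiplicityFamily ν s} => Cardinal.mk s.1)
      Cardinal.bddAbove_of_small ⟨_, hs⟩

theorem CyclicOrth.of_proj_left {x z : H} {Δ : Set ℝ} (hΔ : MeasurableSet Δ)
    (h : E.CyclicOrth (E.proj Δ x) z) : E.CyclicOrth x (E.proj Δ z) := fun s hs => by
  rw [E.proj_comm hs hΔ, ← E.inner_proj_left hΔ, h s hs]

variable (E) in
/-- Every nonzero finite measure has a nonzero restriction with a complete family. -/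
theorem exists_isCompleteFamily_restrict [IsFiniteMeasure ν] (h0 : ν ≠ 0) :
    ∃ Δ, MeasurableSet Δ ∧ ν Δ ≠ 0 ∧
      ∃ (ι : Type u) (x : ι → H), E.IsCompleteFamily (ν.restrict Δ) x := by
  -- A maximal orthogonal family of vectors of measure exactly ν. If its truncation is complete on
  -- no set of positive measure, leftover vectors can be glued to a further member, against
  -- maximality.
  obtain ⟨s, hs, hso, hmax⟩ := exists_maximal_pairwise (fun x : H => E.scalarMeasure x = ν)
    (fun x y => E.CyclicOrth x y)
  by_contra hcon
  push Not at hcon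
  -- The sets over which a leftover vector realizes all of ν.
  let R : Set ℝ → Prop := fun Δ => MeasurableSet Δ ∧
    ∃ z, (∀ x ∈ s, E.CyclicOrth x z) ∧ E.scalarMeasure z = ν.restrict Δ
  have key : ∀ Δ, MeasurableSet Δ → ν Δ ≠ 0 → ∃ Δ' ⊆ Δ, R Δ' ∧ ν Δ' ≠ 0 := by
    intro Δ hΔ hΔ0
    have h1 := hcon Δ hΔ hΔ0 s fun x => E.proj Δ x
    have h2 : ∃ z, E.scalarMeasure z ≪ ν.restrict Δ ∧
        (∀ x ∈ s, E.CyclicOrth (E.proj Δ x) z) ∧ z ≠ 0 := by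
      by_contra h3
      push Not at h3
      refine h1 ⟨fun x => by rw [E.scalarMeasure_proj hΔ, hs x x.2], fun i j hij => ?_,
        fun z hz hzo => h3 z hz fun x hx => hzo ⟨x, hx⟩⟩
      exact ((hso i.2 j.2 fun h => hij (Subtype.ext h)).proj_left hΔ).proj_right hΔ
    obtain ⟨z, hz, hzo, hz0⟩ := h2
    have hzp : E.proj Δ z = z := E.proj_eq_self_of_ac_restrict hΔ hz
    have hzν : E.scalarMeasure z ≪ ν := hz.trans Measure.restrict_le_self.absolutelyContinuous
    obtain ⟨D, hD, hzD, hDz⟩ := exists_restrict_absolutelyContinuous hzν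
    have hDΔ : ν.restrict (D ∩ Δ) ≪ E.scalarMeasure z :=
      (Measure.restrict_mono inter_subset_left le_rfl).absolutelyContinuous.trans hDz
    obtain ⟨y, hy, hyo, -⟩ := exists_scalarMeasure_eq_of_absolutelyContinuous hDΔ
    refine ⟨D ∩ Δ, inter_subset_right, ⟨hD.inter hΔ, y, fun x hx => ?_, hy⟩, fun hDΔ0 => hz0 ?_⟩
    · refine (hyo x ?_).symm
      have := (hzo x hx).of_proj_left hΔ
      rw [hzp] at this
      exact this.symm
    · have h4 : E.proj (D ∩ Δ) z = 0 :=
        E.scalarMeasure_absolutelyContinuous_iff.1 hzν _ (hD.inter hΔ) hDΔ0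
      rwa [← E.proj_proj hD hΔ, hzp, E.proj_eq_self_of_ac_restrict hD hzD] at h4
  have hR0 : R ∅ := ⟨.empty, 0, fun x _ => (cyclicOrth_zero_left x).symm, by
    rw [Measure.restrict_empty, E.scalarMeasure_eq_zero]⟩
  have hRU : ∀ Δ : ℕ → Set ℝ, (∀ n, R (Δ n)) → R (⋃ n, Δ n) := by
    intro Δ hΔ
    choose hm z hzo hz using hΔ
    have hdm : ∀ n, MeasurableSet (disjointed Δ n) := MeasurableSet.disjointed hm
    obtain ⟨w, hw, -, hwν⟩ := E.exists_hasSum_of_disjoint (ν := ν) hdm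
      (fun i j hij => disjoint_disjointed Δ hij) (u := fun n => E.proj (disjointed Δ n) (z n))
      (fun n => E.proj_proj_self (hdm n) _) (fun n => by
        rw [E.scalarMeasure_proj (hdm n), hz, Measure.restrict_restrict (hdm n),
          inter_eq_left.2 (disjointed_subset Δ n)])
    rw [iUnion_disjointed] at hwν
    exact ⟨.iUnion hm, w, fun x hx =>
      CyclicOrth.of_hasSum (fun n => (hzo n x hx).proj_right (hdm n)) hw, hwν⟩
  -- By `key` the largest such set is conull, so z has measure ν and belongs to s, yet it is
  -- orthogonal to s.
  obtain ⟨Δ, ⟨hΔ, z, hzo, hz⟩, hΔmax⟩ := exists_essentially_largest (ν := ν) R hR0 hRU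
  have hΔc : ν Δᶜ = 0 := by
    by_contra h1
    obtain ⟨Δ', hΔ', hR, hne⟩ := key Δᶜ hΔ.compl h1
    exact hne (hΔmax Δ' hR hR.1 (disjoint_compl_left.mono_left hΔ'))
  have hzν : E.scalarMeasure z = ν := by
    rw [hz]
    exact Measure.restrict_eq_self_of_ae_mem (mem_ae_iff.2 hΔc)
  have hzs := hmax z hzν fun x hx => ⟨(hzo x hx).symm, hzo x hx⟩
  have := (hzo z hzs).self_eq_zero
  rw [← E.scalarMeasure_eq_zero, hzν] at this
  exact h0 this

end Multiplicity

-- The multiplicity function as a complete invariant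

section Equivalence

variable {K : Type u} [NormedAddCommGroup K] [InnerProductSpace ℂ K] [CompleteSpace K]
variable {E : SpectralMeasure H} {F : SpectralMeasure K}

/-- Restrict ν until E has a complete family, then again until F has one; the first survives the
second restriction, and equal multiplicities identify the index sets. -/
theorem exists_isCompleteFamily_pair
    (h : ∀ μ : Measure ℝ, IsFiniteMeasure μ → E.multiplicity μ = F.multiplicity μ)
    [IsFiniteMeasure ν] (h0 : ν ≠ 0) :
    ∃ ν', IsFiniteMeasure ν' ∧ ν' ≠ 0 ∧ ν' ≪ ν ∧ ∃ (ι : Type u) (x : ι → H) (y : ι → K),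
      E.IsCompleteFamily ν' x ∧ F.IsCompleteFamily ν' y := by
  obtain ⟨Δ, hΔ, hΔ0, ι, x, hx⟩ := E.exists_isCompleteFamily_restrict h0
  have h1 : ν.restrict Δ ≠ 0 := by rwa [Ne, Measure.restrict_eq_zero]
  obtain ⟨Δ', hΔ', hΔ0', κ, y, hy⟩ := F.exists_isCompleteFamily_restrict h1
  set ν' := (ν.restrict Δ).restrict Δ' with hν'
  have h2 : ν' ≠ 0 := by rwa [hν', Ne, Measure.restrict_eq_zero]
  obtain ⟨x', hx'⟩ := hx.exists_of_absolutelyContinuous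
    (ν' := ν') Measure.restrict_le_self.absolutelyContinuous
  have h3 : Cardinal.mk ι = Cardinal.mk κ := by
    rw [← hx'.multiplicity_eq h2, ← hy.multiplicity_eq h2]
    exact h ν' inferInstance
  obtain ⟨e⟩ := Cardinal.eq.1 h3
  refine ⟨ν', inferInstance, h2,
    (Measure.restrict_le_self.trans Measure.restrict_le_self).absolutelyContinuous, ι, x', y ∘ e,
    hx', fun i => hy.1 _, fun i j hij => hy.2.1 (e.injective.ne hij), fun z hz hzo => ?_⟩
  refine hy.2.2 z hz fun j => ?_
  simpa using hzo (e.symm j)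

/-- The absolutely continuous part of z is a spectral projection of z, so it is orthogonal to the
family too and vanishes by completeness. -/
theorem mutuallySingular_of_isCompleteFamily {ι : Type*} {x : ι → H} [IsFiniteMeasure ν]
    (hx : E.IsCompleteFamily ν x) {z : H} (hz : ∀ i, E.CyclicOrth (x i) z) :
    E.scalarMeasure z ⟂ₘ ν := by
  obtain ⟨N, hN, h1, h2⟩ := E.exists_proj_absolutelyContinuous (ν := ν) z
  exact ⟨N, hN, (E.scalarMeasure_eq_zero_iff hN z).2
    (hx.2.2 _ h1 fun i => (hz i).proj_right hN), h2⟩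

/-- Spectral measures with the same multiplicity function are unitarily equivalent. -/
theorem UnitarilyEquivalent.of_multiplicity_eq
    (h : ∀ μ : Measure ℝ, IsFiniteMeasure μ → E.multiplicity μ = F.multiplicity μ) :
    E.UnitarilyEquivalent F := by
  obtain ⟨S, hS, hSo, hmax⟩ := exists_maximal_pairwise
    (fun ν : Measure ℝ => IsFiniteMeasure ν ∧ ν ≠ 0 ∧ ∃ (ι : Type u) (x : ι → H) (y : ι → K),
      E.IsCompleteFamily ν x ∧ F.IsCompleteFamily ν y) (fun ν ν' => ν ⟂ₘ ν')
  have hfin : ∀ ν : S, IsFiniteMeasure ν.1 := fun ν => (hS ν.1 ν.2).1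
  choose ι x y hx hy using fun ν : S => (hS ν.1 ν.2).2.2
  -- Maximality of S: a nonzero ρ singular to S would dominate a new member. Applied to scalar
  -- measures, this gives totality on both sides.
  have hsing : ∀ ρ : Measure ℝ, IsFiniteMeasure ρ → (∀ ν : S, ρ ⟂ₘ ν.1) → ρ = 0 := by
    intro ρ _ hρ
    by_contra hρ0
    obtain ⟨ν', hν'f, hν'0, hν'ρ, hf⟩ := exists_isCompleteFamily_pair h hρ0
    have h1 : ∀ ν : S, ν' ⟂ₘ ν.1 := fun ν =>
      (hρ ν).mono_ac hν'ρ Measure.AbsolutelyContinuous.rfl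
    have h2 : ν' ∈ S := hmax ν' ⟨hν'f, hν'0, hf⟩ fun ν hν => ⟨h1 ⟨ν, hν⟩, (h1 ⟨ν, hν⟩).symm⟩
    exact hν'0 ((Measure.MutuallySingular.self_iff ν').1 (h1 ⟨ν', h2⟩))
  refine UnitarilyEquivalent.of_isTotal (ι := Σ ν : S, ι ν) (x := fun p => x p.1 p.2)
    (y := fun p => y p.1 p.2) ?_ ?_ ?_ ?_ ?_
  · intro z hz
    rw [← E.scalarMeasure_eq_zero]
    exact hsing _ inferInstance fun ν =>
      mutuallySingular_of_isCompleteFamily (hx ν) fun i => hz ⟨ν, i⟩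
  · intro z hz
    rw [← F.scalarMeasure_eq_zero]
    exact hsing _ inferInstance fun ν =>
      mutuallySingular_of_isCompleteFamily (hy ν) fun i => hz ⟨ν, i⟩
  · rintro ⟨ν, i⟩ ⟨ν', j⟩ hne
    by_cases hνν : ν = ν'
    · subst hνν
      exact (hx ν).2.1 fun hij => hne (congrArg (Sigma.mk ν) hij)
    · refine cyclicOrth_of_mutuallySingular ?_
      simp only [(hx ν).1, (hx ν').1]
      exact hSo ν.2 ν'.2 fun h => hνν (Subtype.ext h)
  · rintro ⟨ν, i⟩ ⟨ν', j⟩ hne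
    by_cases hνν : ν = ν'
    · subst hνν
      exact (hy ν).2.1 fun hij => hne (congrArg (Sigma.mk ν) hij)
    · refine cyclicOrth_of_mutuallySingular ?_
      simp only [(hy ν).1, (hy ν').1]
      exact hSo ν.2 ν'.2 fun h => hνν (Subtype.ext h)
  · rintro ⟨ν, i⟩
    simp only [(hx ν).1, (hy ν).1]

end Equivalence

end SpectralMeasure

namespace SpectralMeasure

variable {H : Type u} [NormedAddCommGroup H] [InnerProductSpace ℂ H] [CompleteSpace H]
variable {K : Type v} [NormedAddCommGroup K] [InnerProductSpace ℂ K] [CompleteSpace K]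
variable {E : SpectralMeasure H} {F : SpectralMeasure K}

-- Spectral type and multiplicity on separable spaces

section Classical

theorem CyclicOrth.of_proj_right {x z : H} {Δ : Set ℝ} (hΔ : MeasurableSet Δ)
    (h : E.CyclicOrth x (E.proj Δ z)) : E.CyclicOrth (E.proj Δ x) z :=
  (h.symm.of_proj_left hΔ).symm

/-- Replacing the scalar spectral measure of a vector by an equivalent one does not change the
cyclic subspace. -/
theorem exists_scalarMeasure_eq_of_equivalent {x : H} {μ : Measure ℝ} [IsFiniteMeasure μ]
    (h : μ ≪ E.scalarMeasure x) (h' : E.scalarMeasure x ≪ μ) :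
    ∃ y, E.scalarMeasure y = μ ∧ ∀ z, E.CyclicOrth y z ↔ E.CyclicOrth x z := by
  obtain ⟨y, hy, h1, h2⟩ := exists_scalarMeasure_eq_of_absolutelyContinuous h
  refine ⟨y, hy, fun z => ⟨fun hz => ?_, h1 z⟩⟩
  obtain ⟨N, hN, hNz, hN0⟩ := E.exists_proj_absolutelyContinuous (ν := μ) z
  have h3 := (h2 _ hNz (hz.proj_right hN)).of_proj_right hN
  rwa [E.proj_eq_self_of_compl hN (E.scalarMeasure_absolutelyContinuous_iff.1 h' _ hN.compl hN0)]
    at h3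

theorem isClassicalTypeAndMultiplicity_iff {μ : Measure ℝ} {n : ℝ → ℕ∞} :
    E.IsClassicalTypeAndMultiplicity μ n ↔ IsFiniteMeasure μ ∧
      (∀ Δ : Set ℝ, MeasurableSet Δ → (μ Δ = 0 ↔ E.proj Δ = 0)) ∧ Measurable n ∧
      ∃ x : ℕ → H, (∀ k : ℕ, E.scalarMeasure (x k) = μ.restrict {t | (k : ℕ∞) < n t}) ∧
        (Pairwise fun j k => E.CyclicOrth (x j) (x k)) ∧ E.IsTotal x := by
  constructor
  · rintro ⟨h1, h2, h3, x, h4, h5, h6⟩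
    exact ⟨h1, h2, h3, x, h4, fun j k hjk => h5 j k hjk, isTotal_of_topologicalClosure_eq_top h6⟩
  · rintro ⟨h1, h2, h3, x, h4, h5, h6⟩
    refine ⟨h1, h2, h3, x, h4, fun j k hjk => h5 hjk, ?_⟩
    refine span_topologicalClosure_eq_top_of_forall_inner fun z hz => h6 z fun k Δ hΔ => ?_
    rw [← E.inner_proj_left hΔ]
    exact hz _ ⟨k, Δ, hΔ, rfl⟩

theorem exists_isTotal_sequence [TopologicalSpace.SeparableSpace H] (E : SpectralMeasure H) :
    ∃ x : ℕ → H, (Pairwise fun j k => E.CyclicOrth (x j) (x k)) ∧ E.IsTotal x := by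
  obtain ⟨s, hs, hso, hmax⟩ := exists_maximal_pairwise (fun x : H => ‖x‖ = 1)
    (fun x y => E.CyclicOrth x y)
  -- Orthogonal unit vectors are at distance √2, so the balls of radius 1/2 are disjoint and
  -- separability applies.
  have hsc : s.Countable := by
    refine Set.PairwiseDisjoint.countable_of_isOpen (s := fun x : H => Metric.ball x (1 / 2))
      (fun x hx y hy hxy => ?_) (fun x _ => Metric.isOpen_ball)
      fun x _ => ⟨x, Metric.mem_ball_self (by norm_num)⟩
    refine Metric.ball_disjoint_ball ?_
    have h1 := norm_sub_sq (𝕜 := ℂ) x y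
    rw [(hso hx hy hxy).inner_eq_zero, hs x hx, hs y hy] at h1
    simp only [map_zero, mul_zero] at h1
    rw [dist_eq_norm]
    nlinarith [norm_nonneg (x - y)]
  obtain ⟨f, hf⟩ := Set.countable_iff_exists_injective.1 hsc
  -- Unused indices carry the zero vector, which is harmless for orthogonality and totality.
  let e : ℕ → H := Function.extend f (fun a : s => (a : H)) 0
  have he : ∀ a, e (f a) = a := fun a => hf.extend_apply _ _ a
  have he' : ∀ n, (∃ a, f a = n) ∨ e n = 0 := fun n => by
    by_cases h : ∃ a, f a = n
    · exact Or.inl h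
    · exact Or.inr (Function.extend_apply' _ _ _ h)
  refine ⟨e, fun j k hjk => ?_, fun z hz => ?_⟩
  · rcases he' j with ⟨a, rfl⟩ | h
    · rcases he' k with ⟨b, rfl⟩ | h
      · simp only [he]
        exact hso a.2 b.2 fun h => hjk (congrArg f (Subtype.ext h))
      · simp only [h]
        exact (cyclicOrth_zero_left _).symm
    · simp only [h]
      exact cyclicOrth_zero_left _
  · by_contra hz0
    have hz1 : ∀ a ∈ s, E.CyclicOrth a (((‖z‖⁻¹ : ℝ) : ℂ) • z) := fun a ha Δ hΔ => by
      have h1 := hz (f ⟨a, ha⟩) Δ hΔ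
      rw [he] at h1
      rw [map_smul, inner_smul_right, h1, mul_zero]
    have hz2 := hmax (((‖z‖⁻¹ : ℝ) : ℂ) • z) (by
      rw [norm_smul, Complex.norm_real, norm_inv, norm_norm, inv_mul_cancel₀ (norm_ne_zero_iff.2 hz0)])
      fun a ha => ⟨(hz1 a ha).symm, hz1 a ha⟩
    have hz3 := (hz1 _ hz2).self_eq_zero
    simp [hz0] at hz3

/-- The sets `{t ∈ D j | exactly k of the sets D i, i < j, contain t}`. -/
theorem exists_rearrangement {D : ℕ → Set ℝ} (hD : ∀ j, MeasurableSet (D j)) :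
    ∃ (B : ℕ → ℕ → Set ℝ) (n : ℝ → ℕ∞), (∀ k j, MeasurableSet (B k j)) ∧ Measurable n ∧
      (∀ k, Pairwise fun i j => Disjoint (B k i) (B k j)) ∧
      (∀ j, Pairwise fun k l => Disjoint (B k j) (B l j)) ∧
      (∀ k, ⋃ j, B k j = {t | (k : ℕ∞) < n t}) ∧ ∀ j, ⋃ k, B k j = D j := by
  let c : ℕ → ℝ → ℕ := fun j t => ∑ i ∈ Finset.range j, (D i).indicator 1 t
  have hc : ∀ j, Measurable (c j) := fun j =>
    Finset.measurable_sum _ fun i _ => measurable_one.indicator (hD i)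
  have hc0 : ∀ t, c 0 t = 0 := fun t => by simp [c]
  have hcs : ∀ j t, c (j + 1) t = c j t + (D j).indicator 1 t := fun j t => by
    simp [c, Finset.sum_range_succ]
  have hcm : ∀ t, Monotone fun j => c j t := fun t => monotone_nat_of_le_succ fun j => by
    rw [hcs]; exact Nat.le_add_right _ _
  have hlt : ∀ {i j t}, i < j → t ∈ D i → c i t < c j t := fun {i j t} hij ht => by
    have h1 : c (i + 1) t ≤ c j t := hcm t hij
    rw [hcs, indicator_of_mem ht] at h1
    exact h1
  -- The number of sets D j containing t: each k < n t is the count at exactly one such j.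
  let n : ℝ → ℕ∞ := fun t => ⨆ j, (c j t : ℕ∞)
  have hB : ∀ k, ⋃ j, (D j ∩ {t | c j t = k}) = {t | (k : ℕ∞) < n t} := fun k => by
    ext t
    simp only [mem_iUnion, mem_inter_iff, mem_ofPred_eq, n, lt_iSup_iff, Nat.cast_lt]
    constructor
    · rintro ⟨j, hj, hk⟩
      exact ⟨j + 1, hk ▸ hlt j.lt_succ_self hj⟩
    · rintro ⟨j, hj⟩
      induction j with
      | zero => rw [hc0] at hj; omega
      | succ j ih =>
        by_cases h : k < c j t
        · exact ih h
        · rw [hcs] at hj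
          by_cases hjD : t ∈ D j
          · rw [indicator_of_mem hjD] at hj
            simp only [Pi.one_apply] at hj
            exact ⟨j, hjD, by omega⟩
          · rw [indicator_of_notMem hjD] at hj
            omega
  have hBm : ∀ k j, MeasurableSet (D j ∩ {t | c j t = k}) := fun k j =>
    (hD j).inter (hc j (measurableSet_singleton k))
  refine ⟨fun k j => D j ∩ {t | c j t = k}, n, hBm, ?_, fun k => ?_, fun j k l hkl => ?_, hB,
    fun j => ?_⟩
  · have h1 : ∀ k : ℕ, MeasurableSet {t | (k : ℕ∞) < n t} := fun k => by
      rw [← hB]; exact .iUnion (hBm k)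
    refine ENat.measurable_iff.2 fun k => ?_
    have h2 : n ⁻¹' {(k : ℕ∞)} = {t | (k : ℕ∞) < n t}ᶜ ∩ ⋂ l : Fin k, {t | ((l : ℕ) : ℕ∞) < n t} := by
      ext t
      simp only [mem_preimage, mem_singleton_iff, mem_inter_iff, mem_compl_iff, mem_ofPred_eq,
        mem_iInter, not_lt]
      constructor
      · intro h
        rw [h]
        exact ⟨le_rfl, fun l => by exact_mod_cast l.2⟩
      · rintro ⟨h, h'⟩
        obtain ⟨m, hm⟩ := ENat.ne_top_iff_exists.1 (h.trans_lt (ENat.natCast_lt_top k)).ne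
        rw [← hm] at h h' ⊢
        rw [Nat.cast_le] at h
        by_contra hne
        have hmk : m < k := lt_of_le_of_ne h fun h => hne (by rw [h])
        exact lt_irrefl _ (h' ⟨m, hmk⟩)
    rw [h2]
    exact (h1 k).compl.inter (.iInter fun l => h1 l)
  · have hwlog : ∀ i j, i < j → Disjoint (D i ∩ {t | c i t = k}) (D j ∩ {t | c j t = k}) := by
      intro i j hij
      rw [disjoint_left]
      rintro t ⟨hti, hci⟩ ⟨_, hcj⟩
      have h1 := hlt hij hti
      simp only [mem_ofPred_eq] at hci hcj
      omega
    intro i j hij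
    rcases lt_or_gt_of_ne hij with h | h
    · exact hwlog i j h
    · exact (hwlog j i h).symm
  · refine disjoint_left.2 ?_
    rintro t ⟨_, hk⟩ ⟨_, hl⟩
    exact hkl (hk.symm.trans hl)
  · ext t
    simp

/-- On a separable space, the classical spectral type and multiplicity function exist. -/
theorem exists_isClassicalTypeAndMultiplicity [TopologicalSpace.SeparableSpace H]
    (E : SpectralMeasure H) :
    ∃ (μ : Measure ℝ) (n : ℝ → ℕ∞), E.IsClassicalTypeAndMultiplicity μ n := by
  obtain ⟨e, heo, het⟩ := exists_isTotal_sequence E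
  -- The sum of the scalar measures may be infinite; `toFinite` replaces it by a finite measure with
  -- the same null sets.
  set μ := (Measure.sum fun j => E.scalarMeasure (e j)).toFinite with hμ
  have hμe : ∀ j, E.scalarMeasure (e j) ≪ μ := fun j =>
    (Measure.le_sum (fun j => E.scalarMeasure (e j)) j).absolutelyContinuous.trans
      (absolutelyContinuous_toFinite _)
  have hnull : ∀ Δ, MeasurableSet Δ → (μ Δ = 0 ↔ E.proj Δ = 0) := by
    intro Δ hΔ
    constructor
    · intro h
      ext z
      refine het _ fun j => ?_
      refine CyclicOrth.of_proj_left hΔ ?_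
      rw [E.scalarMeasure_absolutelyContinuous_iff.1 (hμe j) Δ hΔ h]
      exact cyclicOrth_zero_left z
    · intro h
      refine toFinite_absolutelyContinuous _ ?_
      rw [Measure.sum_apply _ hΔ, ENNReal.tsum_eq_zero]
      intro j
      rw [E.scalarMeasure_eq_zero_iff hΔ, h]
      rfl
  choose D hD heD hDe using fun j => exists_restrict_absolutelyContinuous (hμe j)
  choose y hy hyo using fun j => exists_scalarMeasure_eq_of_equivalent (hDe j) (heD j)
  obtain ⟨B, n, hBm, hn, hB1, hB2, hBn, hBD⟩ := exists_rearrangement hD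
  have hBsub : ∀ k j, B k j ⊆ D j := fun k j => hBD j ▸ subset_iUnion (fun k => B k j) k
  -- The vector x k collects, over each t, the k-th generator y j alive at t; over t exactly the
  -- first n t vectors are then nonzero.
  choose x hx hxB hxμ using fun k => E.exists_hasSum_of_disjoint (ν := μ) (hBm k) (hB1 k)
    (u := fun j => E.proj (B k j) (y j)) (fun j => E.proj_proj_self (hBm k j) _) (fun j => by
      rw [E.scalarMeasure_proj (hBm k j), hy, Measure.restrict_restrict (hBm k j),
        inter_eq_left.2 (hBsub k j)])
  have hyy : Pairwise fun i j => E.CyclicOrth (y i) (y j) := fun i j hij =>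
    (hyo i _).2 ((hyo j _).2 (heo hij).symm).symm
  refine ⟨μ, n, isClassicalTypeAndMultiplicity_iff.2 ⟨inferInstance, hnull, hn, x, fun k => ?_,
    fun k l hkl => ?_, fun z hz => het z fun j => (hyo j z).1 ?_⟩⟩
  · rw [hxμ, hBn]
  · refine CyclicOrth.of_hasSum (fun j => CyclicOrth.symm ?_) (hx l)
    refine CyclicOrth.of_hasSum (fun i => ?_) (hx k)
    by_cases hij : i = j
    · subst hij
      exact cyclicOrth_proj_proj_of_disjoint (hBm l i) (hBm k i) (hB2 i hkl.symm) _ _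
    · exact ((hyy fun h => hij h.symm).proj_left (hBm l j)).proj_right (hBm k i)
  · have h1 := E.hasSum_iUnion (fun k => B k j) (fun k => hBm k j) (hB2 j) (y j)
    rw [hBD j, E.proj_eq_self_of_ac_restrict (hD j) (ν := μ) (by rw [hy])] at h1
    refine (CyclicOrth.of_hasSum (fun k => ?_) h1).symm
    rw [← hxB k j]
    exact ((hz k).proj_left (hBm k j)).symm

/-- If n' = m < n on a set Δ of positive measure, then over Δ the primed vectors form a complete
family of m members while the others provide m + 1 orthogonal copies, against
`IsCompleteFamily.mk_le`. -/
theorem IsClassicalTypeAndMultiplicity.le {μ μ' : Measure ℝ} {n n' : ℝ → ℕ∞}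
    (h : E.IsClassicalTypeAndMultiplicity μ n) (h' : E.IsClassicalTypeAndMultiplicity μ' n') :
    μ ≪ μ' ∧ n ≤ᵐ[μ] n' := by
  obtain ⟨hμ, hnull, hn, x, hx, hxo, hxt⟩ := isClassicalTypeAndMultiplicity_iff.1 h
  obtain ⟨hμ', hnull', hn', x', hx', hxo', hxt'⟩ := isClassicalTypeAndMultiplicity_iff.1 h'
  have hac : μ ≪ μ' := Measure.AbsolutelyContinuous.mk fun s hs h0 =>
    (hnull s hs).2 ((hnull' s hs).1 h0)
  refine ⟨hac, ?_⟩
  rw [Filter.EventuallyLE, ae_iff]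
  have hm : ∀ m : ℕ, MeasurableSet {t | (m : ℕ∞) < n t} := fun m => hn (MeasurableSet.of_discrete
    (s := {a : ℕ∞ | (m : ℕ∞) < a}))
  have hm' : ∀ m : ℕ, MeasurableSet {t | (m : ℕ∞) < n' t} := fun m => hn' (MeasurableSet.of_discrete
    (s := {a : ℕ∞ | (m : ℕ∞) < a}))
  refine measure_mono_null (t := ⋃ m : ℕ, {t | n' t = m} ∩ {t | (m : ℕ∞) < n t}) ?_
    (measure_iUnion_null fun m => ?_)
  · intro t ht
    rw [mem_ofPred_eq, not_le] at ht
    obtain ⟨m, hm⟩ := ENat.ne_top_iff_exists.1 (ht.trans_le le_top).ne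
    exact mem_iUnion.2 ⟨m, hm.symm, by rw [← hm] at ht; exact ht⟩
  · set Δ := {t | n' t = m} ∩ {t | (m : ℕ∞) < n t} with hΔdef
    have hΔ : MeasurableSet Δ := (hn' (measurableSet_singleton _)).inter (hm m)
    by_contra h0
    have hcomplete : E.IsCompleteFamily (μ'.restrict Δ) fun k : Fin m => E.proj Δ (x' k) := by
      refine ⟨fun k => ?_, fun i j hij => ?_, fun z hz hzo => hxt' z fun k => ?_⟩
      · rw [E.scalarMeasure_proj hΔ, hx', Measure.restrict_restrict hΔ, inter_eq_left.2]
        rintro t ⟨ht, _⟩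
        rw [mem_ofPred_eq] at ht ⊢
        rw [ht]
        exact_mod_cast k.2
      · exact ((hxo' fun h => hij (Fin.ext h)).proj_left hΔ).proj_right hΔ
      · have hzΔ := E.proj_eq_self_of_ac_restrict hΔ hz
        by_cases hk : k < m
        · have h1 := (hzo ⟨k, hk⟩).of_proj_left hΔ
          rwa [hzΔ] at h1
        · rw [← hzΔ]
          refine CyclicOrth.of_proj_left hΔ ?_
          have h1 : E.proj Δ (x' k) = 0 := by
            rw [← E.scalarMeasure_eq_zero_iff hΔ, hx', Measure.restrict_apply hΔ]
            have h2 : Δ ∩ {t | (k : ℕ∞) < n' t} = ∅ := by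
              ext t
              simp only [hΔdef, mem_inter_iff, mem_ofPred_eq, mem_empty_iff_false, iff_false]
              rintro ⟨⟨h3, _⟩, h4⟩
              rw [h3, Nat.cast_lt] at h4
              exact hk h4
            rw [h2, measure_empty]
          rw [h1]
          exact cyclicOrth_zero_left z
    have hle := hcomplete.mk_le (κ := Fin (m + 1)) (ν' := μ.restrict Δ) (hac.restrict Δ)
      (by rwa [Ne, Measure.restrict_eq_zero]) (y := fun k => E.proj Δ (x k)) (fun k => by
        rw [E.scalarMeasure_proj hΔ, hx, Measure.restrict_restrict hΔ, inter_eq_left.2]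
        rintro t ⟨_, ht⟩
        rw [mem_ofPred_eq] at ht ⊢
        refine lt_of_le_of_lt ?_ ht
        exact_mod_cast Nat.lt_succ_iff.1 k.2)
      fun i j hij => ((hxo fun h => hij (Fin.ext h)).proj_left hΔ).proj_right hΔ
    rw [Cardinal.mk_fin, Cardinal.mk_fin, Nat.cast_le] at hle
    omega

theorem IsClassicalTypeAndMultiplicity.map {μ : Measure ℝ} {n : ℝ → ℕ∞}
    (h : E.IsClassicalTypeAndMultiplicity μ n) (hEF : E.UnitarilyEquivalent F) :
    F.IsClassicalTypeAndMultiplicity μ n := by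
  obtain ⟨hμ, hnull, hn, x, hx, hxo, hxt⟩ := isClassicalTypeAndMultiplicity_iff.1 h
  obtain ⟨U, hU⟩ := hEF
  have ho : ∀ a b, F.CyclicOrth (U a) (U b) ↔ E.CyclicOrth a b := fun a b =>
    forall₂_congr fun Δ hΔ => by rw [← hU Δ hΔ, U.inner_map_map]
  refine isClassicalTypeAndMultiplicity_iff.2 ⟨hμ, fun Δ hΔ => ?_, hn, fun k => U (x k),
    fun k => ?_, fun j k hjk => (ho _ _).2 (hxo hjk), fun z hz => ?_⟩
  · rw [hnull Δ hΔ]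
    constructor
    · intro h0
      ext z
      obtain ⟨w, rfl⟩ := U.surjective z
      rw [← hU Δ hΔ, h0]
      simp
    · intro h0
      ext z
      refine U.injective ?_
      rw [hU Δ hΔ, h0]
      simp
  · rw [scalarMeasure_map U hU, hx]
  · obtain ⟨w, rfl⟩ := U.surjective z
    rw [hxt w fun k => (ho _ _).1 (hz k), map_zero]

/-- The classical spectral type and multiplicity function form a complete unitary invariant. -/
theorem IsClassicalTypeAndMultiplicity.unitarilyEquivalent_iff {μ μ' : Measure ℝ} {n n' : ℝ → ℕ∞}
    (h : E.IsClassicalTypeAndMultiplicity μ n) (h' : F.IsClassicalTypeAndMultiplicity μ' n') :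
    E.UnitarilyEquivalent F ↔ μ ≪ μ' ∧ μ' ≪ μ ∧ n =ᵐ[μ] n' := by
  constructor
  · intro hEF
    obtain ⟨h1, h2⟩ := (h.map hEF).le h'
    obtain ⟨h3, h4⟩ := h'.le (h.map hEF)
    exact ⟨h1, h3, h2.antisymm (h1.ae_le h4)⟩
  · rintro ⟨h1, h2, hnn⟩
    obtain ⟨hμ, -, -, x, hx, hxo, hxt⟩ := isClassicalTypeAndMultiplicity_iff.1 h
    obtain ⟨hμ', -, -, x', hx', hxo', hxt'⟩ := isClassicalTypeAndMultiplicity_iff.1 h'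
    have hset : ∀ k : ℕ, μ.restrict {t | (k : ℕ∞) < n t} = μ.restrict {t | (k : ℕ∞) < n' t} :=
      fun k => Measure.restrict_congr_set (Filter.eventuallyEq_set.2 (by
        filter_upwards [hnn] with t ht
        simp only [ht]))
    -- Change the generators of F so that their scalar measures equal those of E instead of being
    -- merely equivalent.
    choose y hy hyo using fun k => exists_scalarMeasure_eq_of_equivalent (E := F) (x := x' k)
      (μ := μ.restrict {t | (k : ℕ∞) < n t})
      (by rw [hset, hx']; exact h1.restrict _) (by rw [hset, hx']; exact h2.restrict _)
    refine UnitarilyEquivalent.of_isTotal (y := y) hxt (fun z hz => hxt' z fun k =>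
      (hyo k z).1 (hz k)) hxo (fun j k hjk => (hyo j _).2 ((hyo k _).2 (hxo' hjk).symm).symm)
      fun k => by rw [hx, hy]

end Classical

end SpectralMeasure

-- Hilbert dimension

section HilbertDim

variable {H : Type u} [NormedAddCommGroup H] [InnerProductSpace ℂ H] [CompleteSpace H]
variable {K : Type u} [NormedAddCommGroup K] [InnerProductSpace ℂ K] [CompleteSpace K]

/-- Cardinals are well-ordered and a Hilbert basis exists, so the infimum is attained; equal
dimensions then provide equinumerous bases. -/
theorem exists_mk_eq_hilbertDim (H : Type u) [NormedAddCommGroup H] [InnerProductSpace ℂ H]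
    [CompleteSpace H] : ∃ s : Set H, Orthonormal ℂ (fun x : s => (x : H)) ∧
      (Submodule.span ℂ s).topologicalClosure = ⊤ ∧ Cardinal.mk s = hilbertDim H := by
  obtain ⟨s, b, hb⟩ := exists_hilbertBasis ℂ H
  refine csInf_mem (s := {κ | ∃ s : Set H, Orthonormal ℂ (fun x : s => (x : H)) ∧
    (Submodule.span ℂ s).topologicalClosure = ⊤ ∧ Cardinal.mk s = κ}) ⟨_, s, ?_, ?_, rfl⟩
  · have := b.orthonormal
    rwa [hb] at this
  · have := b.dense_span
    rwa [hb, Subtype.range_coe] at this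

theorem hilbertDim_le_of_linearIsometryEquiv (e : H ≃ₗᵢ[ℂ] K) : hilbertDim K ≤ hilbertDim H := by
  obtain ⟨s, hs, hsd, hcard⟩ := exists_mk_eq_hilbertDim H
  have he : Function.Injective fun x : s => e x := e.injective.comp Subtype.val_injective
  refine csInf_le' ⟨range fun x : s => e x, ?_, ?_, ?_⟩
  · exact (hs.comp_linearIsometryEquiv e).toSubtypeRange
  · refine span_topologicalClosure_eq_top_of_forall_inner fun z hz => ?_
    have h1 : e.symm z = 0 := eq_zero_of_span_topologicalClosure_eq_top hsd fun x hx => by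
      rw [← e.inner_map_map, e.apply_symm_apply]
      exact hz _ ⟨⟨x, hx⟩, rfl⟩
    simpa using h1
  · rw [Cardinal.mk_range_eq _ he, hcard]

theorem hilbertDim_eq_of_linearIsometryEquiv (e : H ≃ₗᵢ[ℂ] K) : hilbertDim H = hilbertDim K :=
  le_antisymm (hilbertDim_le_of_linearIsometryEquiv e.symm) (hilbertDim_le_of_linearIsometryEquiv e)

end HilbertDim

-- Classification of diagonal operators by their eigenspaces

section Diagonal

variable {H : Type u} [NormedAddCommGroup H] [InnerProductSpace ℂ H]
variable {K : Type u} [NormedAddCommGroup K] [InnerProductSpace ℂ K]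

theorem mem_ker_smul_one_sub {A : H →L[ℂ] H} {c : ℂ} {x : H} :
    x ∈ LinearMap.ker (c • (1 : H →L[ℂ] H) - A).toLinearMap ↔ A x = c • x := by
  change c • x - A x = 0 ↔ _
  rw [sub_eq_zero, eq_comm]

theorem inner_eq_zero_of_apply_eq_smul {A : H →L[ℂ] H} (hA : A.toLinearMap.IsSymmetric)
    {c d : ℂ} (hcd : c ≠ d) {x y : H} (hx : A x = c • x) (hy : A y = d • y) : ⟪x, y⟫_ℂ = 0 :=
  hA.orthogonalFamily_eigenspaces hcd ⟨x, Module.End.mem_eigenspace_iff.2 hx⟩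
    ⟨y, Module.End.mem_eigenspace_iff.2 hy⟩

theorem inner_eigenvector_family {A : H →L[ℂ] H} (hA : A.toLinearMap.IsSymmetric)
    {s : ∀ c : ℂ, Set (LinearMap.ker (c • (1 : H →L[ℂ] H) - A).toLinearMap)}
    (hs : ∀ c, Orthonormal ℂ fun x : s c => (x : LinearMap.ker
      (c • (1 : H →L[ℂ] H) - A).toLinearMap)) (p q : Σ c, s c) [Decidable (p = q)] :
    ⟪((p.2 : LinearMap.ker (p.1 • (1 : H →L[ℂ] H) - A).toLinearMap) : H),
      ((q.2 : LinearMap.ker (q.1 • (1 : H →L[ℂ] H) - A).toLinearMap) : H)⟫_ℂ =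
        if p = q then 1 else 0 := by
  classical
  obtain ⟨c, x⟩ := p
  obtain ⟨d, y⟩ := q
  by_cases hcd : c = d
  · subst hcd
    have h1 := orthonormal_iff_ite.1 (hs c) x y
    simp only [Sigma.mk.injEq, heq_eq_eq, true_and]
    rw [← Submodule.coe_inner, h1]
  · rw [if_neg fun h => hcd (congrArg Sigma.fst h)]
    exact inner_eq_zero_of_apply_eq_smul hA hcd (mem_ker_smul_one_sub.1 x.1.2)
      (mem_ker_smul_one_sub.1 y.1.2)

variable [CompleteSpace H] [CompleteSpace K]

instance completeSpace_ker (A : H →L[ℂ] H) : CompleteSpace (LinearMap.ker A.toLinearMap) :=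
  A.isClosed_ker.completeSpace_coe

theorem UnitarilyEquivalent.hilbertDim_ker_eq {A : H →L[ℂ] H} {B : K →L[ℂ] K}
    (h : UnitarilyEquivalent A B) (c : ℂ) :
    hilbertDim (LinearMap.ker (c • (1 : H →L[ℂ] H) - A).toLinearMap) =
      hilbertDim (LinearMap.ker (c • (1 : K →L[ℂ] K) - B).toLinearMap) := by
  obtain ⟨U, hU⟩ := h
  have hU' : ∀ x, U.symm (B x) = A (U.symm x) := fun x => by
    rw [← U.apply_symm_apply (B x), U.symm_apply_apply, U.symm_apply_eq, hU, U.apply_symm_apply]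
  refine hilbertDim_eq_of_linearIsometryEquiv
    { toFun := fun x => ⟨U x, mem_ker_smul_one_sub.2 ?_⟩
      invFun := fun y => ⟨U.symm y, mem_ker_smul_one_sub.2 ?_⟩
      map_add' := fun x y => Subtype.ext (U.map_add x y)
      map_smul' := fun a x => Subtype.ext (U.map_smul a x)
      left_inv := fun x => Subtype.ext (U.symm_apply_apply x)
      right_inv := fun y => Subtype.ext (U.apply_symm_apply y)
      norm_map' := fun x => U.norm_map x }
  · rw [← hU, mem_ker_smul_one_sub.1 x.2, map_smul]
  · rw [← hU', mem_ker_smul_one_sub.1 y.2, map_smul]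

/-- Orthonormal bases of the eigenspaces of a diagonal symmetric operator make up a total set. -/
theorem IsDiagonal.span_topologicalClosure_eq_top {A : H →L[ℂ] H} (hA : IsDiagonal A)
    {s : ∀ c : ℂ, Set (LinearMap.ker (c • (1 : H →L[ℂ] H) - A).toLinearMap)}
    (hs : ∀ c, (Submodule.span ℂ (s c)).topologicalClosure = ⊤) :
    (Submodule.span ℂ (range fun p : Σ c, s c => ((p.2 : LinearMap.ker
      (p.1 • (1 : H →L[ℂ] H) - A).toLinearMap) : H))).topologicalClosure = ⊤ := by
  refine span_topologicalClosure_eq_top_of_forall_inner fun z hz => ?_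
  obtain ⟨J, e, c, he⟩ := hA
  refine eq_zero_of_span_topologicalClosure_eq_top e.dense_span ?_
  rintro _ ⟨j, rfl⟩
  set V := LinearMap.ker (c j • (1 : H →L[ℂ] H) - A).toLinearMap with hV
  -- The projection of z to the eigenspace of e j is orthogonal to a total set there, hence zero, so
  -- z is orthogonal to e j.
  have h1 : ∀ x ∈ s (c j), ⟪x, V.orthogonalProjectionOnto z⟫_ℂ = 0 := fun x hx => by
    rw [Submodule.inner_orthogonalProjectionOnto_eq_of_mem_left]
    exact hz _ ⟨⟨c j, ⟨x, hx⟩⟩, rfl⟩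
  have h2 := eq_zero_of_span_topologicalClosure_eq_top (hs (c j)) h1
  have h3 := Submodule.inner_orthogonalProjectionOnto_eq_of_mem_left
    (⟨e j, mem_ker_smul_one_sub.2 (he j)⟩ : V) z
  rw [h2, inner_zero_right] at h3
  exact h3.symm

/-- Diagonal symmetric operators are classified by the dimensions of their eigenspaces. -/
theorem IsDiagonal.unitarilyEquivalent_iff {A : H →L[ℂ] H} {B : K →L[ℂ] K}
    (hA : IsDiagonal A) (hB : IsDiagonal B) (hAs : A.toLinearMap.IsSymmetric)
    (hBs : B.toLinearMap.IsSymmetric) : UnitarilyEquivalent A B ↔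
      ∀ c : ℂ, hilbertDim (LinearMap.ker (c • (1 : H →L[ℂ] H) - A).toLinearMap) =
        hilbertDim (LinearMap.ker (c • (1 : K →L[ℂ] K) - B).toLinearMap) := by
  classical
  refine ⟨fun h c => h.hilbertDim_ker_eq c, fun h => ?_⟩
  choose s hso hsd hsc using fun c : ℂ =>
    exists_mk_eq_hilbertDim (LinearMap.ker (c • (1 : H →L[ℂ] H) - A).toLinearMap)
  choose t hto htd htc using fun c : ℂ =>
    exists_mk_eq_hilbertDim (LinearMap.ker (c • (1 : K →L[ℂ] K) - B).toLinearMap)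
  have hst : ∀ c, Nonempty (s c ≃ t c) := fun c =>
    Cardinal.eq.1 (by rw [hsc, htc, h])
  let e : (Σ c, s c) ≃ Σ c, t c := Equiv.sigmaCongrRight fun c => (hst c).some
  let a : (Σ c, s c) → H := fun p => ((p.2 : LinearMap.ker
    (p.1 • (1 : H →L[ℂ] H) - A).toLinearMap) : H)
  let b : (Σ c, t c) → K := fun p => ((p.2 : LinearMap.ker
    (p.1 • (1 : K →L[ℂ] K) - B).toLinearMap) : K)
  have hb := hB.span_topologicalClosure_eq_top htd
  rw [← e.surjective.range_comp] at hb
  have ha := hA.span_topologicalClosure_eq_top hsd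
  obtain ⟨U, hU⟩ := exists_linearIsometryEquiv_of_inner_eq a (b ∘ e) (fun p q => by
    have h1 := inner_eigenvector_family hAs hso p q
    have h2 := inner_eigenvector_family hBs hto (e p) (e q)
    simp only [e.injective.eq_iff] at h2
    exact h1.trans h2.symm) ha hb
  refine ⟨U, fun z => ?_⟩
  have h1 : (U.toContinuousLinearEquiv : H →L[ℂ] K) ∘L A =
      B ∘L (U.toContinuousLinearEquiv : H →L[ℂ] K) := by
    refine ContinuousLinearMap.ext_on (s := range a) ?_ ?_
    · rw [Submodule.dense_iff_topologicalClosure_eq_top]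
      exact ha
    · rintro _ ⟨p, rfl⟩
      have h2 : A (a p) = p.1 • a p := mem_ker_smul_one_sub.1 p.2.1.2
      have h3 : B (b (e p)) = p.1 • b (e p) := mem_ker_smul_one_sub.1 (e p).2.1.2
      have h4 : U (a p) = b (e p) := hU p
      change U (A (a p)) = B (U (a p))
      rw [h2, map_smul, h4, h3]
  exact congrArg (fun T : H →L[ℂ] K => T z) h1

end Diagonal

-- Weighted shifts and their zeroth weights

section Shift

variable {M : Type u} [NormedAddCommGroup M] [InnerProductSpace ℂ M]
variable {M' : Type v} [NormedAddCommGroup M'] [InnerProductSpace ℂ M']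

/-- A unitary acting coordinatewise on `ℓ²`. -/
def ellTwoCongr (U : M ≃ₗᵢ[ℂ] M') : EllTwo M ≃ₗᵢ[ℂ] EllTwo M' where
  toFun h := ⟨fun n => U (h n), (lp.memℓp h).mono' fun n => (U.norm_map (h n)).le⟩
  invFun h := ⟨fun n => U.symm (h n), (lp.memℓp h).mono' fun n => (U.symm.norm_map (h n)).le⟩
  map_add' h g := Subtype.ext (funext fun n => U.map_add (h n) (g n))
  map_smul' c h := by ext n; simp
  left_inv h := by ext n; simp
  right_inv h := by ext n; simp
  norm_map' h := by
    rw [lp.norm_eq_tsum_rpow (by norm_num), lp.norm_eq_tsum_rpow (by norm_num)]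
    congr 1
    exact tsum_congr fun n => congrArg (fun r : ℝ => r ^ (2 : ℝ≥0∞).toReal) (U.norm_map (h n))

theorem ellTwoCongr_apply (U : M ≃ₗᵢ[ℂ] M') (h : EllTwo M) (n : ℕ) :
    ellTwoCongr U h n = U (h n) := rfl

theorem IsWeightedShift.unitarilyEquivalent {W : EllTwo M →L[ℂ] EllTwo M}
    {W' : EllTwo M' →L[ℂ] EllTwo M'} {w : ℕ → M →L[ℂ] M} {w' : ℕ → M' →L[ℂ] M'}
    (hW : IsWeightedShift W w) (hW' : IsWeightedShift W' w') (U : M ≃ₗᵢ[ℂ] M')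
    (hU : ∀ n h, U (w n h) = w' n (U h)) : UnitarilyEquivalent W W' := by
  refine ⟨ellTwoCongr U, fun h => ?_⟩
  ext n
  rw [ellTwoCongr_apply]
  cases n with
  | zero => rw [(hW h).1, (hW' _).1, map_zero]
  | succ n => rw [(hW h).2, (hW' _).2, hU, ellTwoCongr_apply]

theorem IsWeightedShift.apply_single {W : EllTwo M →L[ℂ] EllTwo M} {w : ℕ → M →L[ℂ] M}
    (hW : IsWeightedShift W w) (n : ℕ) (a : M) :
    W (lp.single 2 n a) = lp.single 2 (n + 1) (w n a) := by
  ext m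
  cases m with
  | zero => rw [(hW _).1, lp.single_apply_ne _ _ _ (by omega)]
  | succ m =>
    rw [(hW _).2]
    by_cases h : m = n
    · subst h
      rw [lp.single_apply_self, lp.single_apply_self]
    · rw [lp.single_apply_ne _ _ _ h, lp.single_apply_ne _ _ _ (by omega), map_zero]

/-- For weights that are bounded below, the vectors orthogonal to the range of a weighted shift
are those living on the zeroth coordinate. -/
theorem IsWeightedShift.eq_single_iff {W : EllTwo M →L[ℂ] EllTwo M} {w : ℕ → M →L[ℂ] M}
    (hW : IsWeightedShift W w) (hw : ∀ n a, ⟪w n a, a⟫_ℂ = 0 → a = 0) (g : EllTwo M) :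
    (∀ h, ⟪W h, g⟫_ℂ = 0) ↔ g = lp.single 2 0 (g 0) := by
  constructor
  · intro hg
    ext m
    cases m with
    | zero => rw [lp.single_apply_self]
    | succ m =>
      rw [lp.single_apply_ne _ _ _ (by omega)]
      refine hw m _ ?_
      -- Shifting the coordinate g (m + 1) from place m tests g against w m (g (m + 1)) at place m +
      -- 1.
      have := hg (lp.single 2 m (g (m + 1)))
      rwa [hW.apply_single, lp.inner_single_left] at this
  · intro hg h
    rw [hg, lp.inner_single_right, (hW h).1, inner_zero_left]

variable [CompleteSpace M]

/-- Unitarily equivalent weighted shifts with positive injective weights have unitarily equivalent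
zeroth weights. -/
theorem IsWeightedShift.unitarilyEquivalent_weight_zero {W : EllTwo M →L[ℂ] EllTwo M}
    {W' : EllTwo M' →L[ℂ] EllTwo M'} {w : ℕ → M →L[ℂ] M} {w' : ℕ → M' →L[ℂ] M'}
    (hW : IsWeightedShift W w) (hW' : IsWeightedShift W' w')
    (hw : ∀ n a, ⟪w n a, a⟫_ℂ = 0 → a = 0) (hw' : ∀ n a, ⟪w' n a, a⟫_ℂ = 0 → a = 0)
    (hp : (w 0).IsPositive) (hp' : (w' 0).IsPositive) (h : UnitarilyEquivalent W W') :
    UnitarilyEquivalent (w 0) (w' 0) := by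
  obtain ⟨U, hU⟩ := h
  have hU' : ∀ x, U.symm (W' x) = W (U.symm x) := fun x => by
    rw [U.symm_apply_eq, hU, U.apply_symm_apply]
  -- U maps the orthogonal complement of the range of W into that of W', that is, zeroth coordinate
  -- space into zeroth coordinate space.
  have h1 : ∀ a : M, U (lp.single 2 0 a) = lp.single 2 0 (U (lp.single 2 0 a) 0) := fun a => by
    refine (hW'.eq_single_iff hw' _).1 fun g => ?_
    rw [← U.symm.inner_map_map, hU', U.symm_apply_apply]
    refine (hW.eq_single_iff hw _).2 ?_ _
    rw [lp.single_apply_self]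
  have h2 : ∀ a : M', U.symm (lp.single 2 0 a) = lp.single 2 0 (U.symm (lp.single 2 0 a) 0) :=
    fun a => by
      refine (hW.eq_single_iff hw _).1 fun g => ?_
      rw [← U.inner_map_map, hU, U.apply_symm_apply]
      refine (hW'.eq_single_iff hw' _).2 ?_ _
      rw [lp.single_apply_self]
  let U₀ : M ≃ₗᵢ[ℂ] M' :=
    { toFun := fun a => U (lp.single 2 0 a) 0
      invFun := fun a => U.symm (lp.single 2 0 a) 0
      map_add' := fun a b => by simp [lp.single_add]
      map_smul' := fun c a => by simp [lp.single_smul]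
      left_inv := fun a => by
        simp only
        rw [← h1, U.symm_apply_apply, lp.single_apply_self]
      right_inv := fun a => by
        simp only
        rw [← h2, U.apply_symm_apply, lp.single_apply_self]
      norm_map' := fun a => by
        have h3 := lp.norm_single (E := fun _ : ℕ => M') (p := 2) (by norm_num) 0
          (U (lp.single 2 0 a) 0)
        rw [← h1, U.norm_map, lp.norm_single (by norm_num)] at h3
        exact h3.symm }
  -- Both sides are norms of vectors that U identifies: the shifted copies of a and U₀ a.
  have h3 : ∀ a, ‖w 0 a‖ = ‖w' 0 (U₀ a)‖ := fun a => by
    have h4 := lp.norm_single (E := fun _ : ℕ => M) (p := 2) (by norm_num) (0 + 1) (w 0 a)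
    have h5 := lp.norm_single (E := fun _ : ℕ => M') (p := 2) (by norm_num) (0 + 1) (w' 0 (U₀ a))
    rw [← hW.apply_single, ← U.norm_map, hU, h1] at h4
    rw [← hW'.apply_single] at h5
    exact h4.symm.trans h5
  let S : M →L[ℂ] M := (U₀.symm.toContinuousLinearEquiv : M' →L[ℂ] M) ∘L w' 0 ∘L
    (U₀.toContinuousLinearEquiv : M →L[ℂ] M')
  have hSa : ∀ a, S a = U₀.symm (w' 0 (U₀ a)) := fun a => rfl
  have hS : ∀ a b, ⟪S a, b⟫_ℂ = ⟪w' 0 (U₀ a), U₀ b⟫_ℂ := fun a b => by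
    rw [hSa, ← U₀.inner_map_map, U₀.apply_symm_apply]
  have hSp : S.IsPositive := by
    refine ⟨fun a b => ?_, fun a => ?_⟩
    · have h4 : ⟪a, S b⟫_ℂ = ⟪U₀ a, w' 0 (U₀ b)⟫_ℂ := by
        rw [hSa, ← U₀.inner_map_map, U₀.apply_symm_apply]
      exact (hS a b).trans ((hp'.1 _ _).trans h4.symm)
    · have := hp'.2 (U₀ a)
      rw [ContinuousLinearMap.reApplyInnerSelf_apply] at this ⊢
      rwa [hS]
  have h4 : w 0 * w 0 = S * S := by
    refine continuousLinearMap_eq_of_inner_self fun a => ?_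
    have h5 : ⟪a, (w 0 * w 0) a⟫_ℂ = ⟪w 0 a, w 0 a⟫_ℂ := (hp.1 a (w 0 a)).symm
    have h6 : ⟪a, (S * S) a⟫_ℂ = ⟪S a, S a⟫_ℂ := (hSp.1 a (S a)).symm
    rw [h5, h6, inner_self_eq_norm_sq_to_K, inner_self_eq_norm_sq_to_K, h3, hSa,
      LinearIsometryEquiv.norm_map]
  -- Positive operators with equal squares coincide.
  have h5 : w 0 = S := (CFC.mul_self_eq_mul_self_iff (w 0) S
    ((ContinuousLinearMap.nonneg_iff_isPositive _).2 hp)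
    ((ContinuousLinearMap.nonneg_iff_isPositive _).2 hSp)).1 h4
  refine ⟨U₀, fun a => ?_⟩
  rw [h5, hSa, U₀.apply_symm_apply]

end Shift

namespace SpectralMeasure

-- Transport of spectral measures and positivity of integrals

section Operators

variable {H : Type u} [NormedAddCommGroup H] [InnerProductSpace ℂ H] [CompleteSpace H]
variable {K : Type v} [NormedAddCommGroup K] [InnerProductSpace ℂ K] [CompleteSpace K]
variable {E : SpectralMeasure H} {F : SpectralMeasure K}

/-- The spectral measure `U⁻¹ F(·) U`. -/
def comap (F : SpectralMeasure K) (U : H ≃ₗᵢ[ℂ] K) : SpectralMeasure H where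
  proj Δ := (U.symm.toContinuousLinearEquiv : K →L[ℂ] H) ∘L F.proj Δ ∘L
    (U.toContinuousLinearEquiv : H →L[ℂ] K)
  isStarProjection Δ hΔ := by
    refine ⟨?_, ?_⟩
    · ext h
      change U.symm (F.proj Δ (U (U.symm (F.proj Δ (U h))))) = U.symm (F.proj Δ (U h))
      rw [U.apply_symm_apply, F.proj_proj_self hΔ]
    · refine LinearMap.IsSymmetric.isSelfAdjoint fun x y => ?_
      change ⟪U.symm (F.proj Δ (U x)), y⟫_ℂ = ⟪x, U.symm (F.proj Δ (U y))⟫_ℂ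
      rw [← U.inner_map_map, ← U.inner_map_map x, U.apply_symm_apply, U.apply_symm_apply,
        F.inner_proj_left hΔ]
  proj_univ := by
    ext h
    change U.symm (F.proj univ (U h)) = h
    rw [F.proj_univ]
    exact U.symm_apply_apply h
  hasSum_iUnion s hs hd h :=
    (U.symm.toContinuousLinearEquiv : K →L[ℂ] H).hasSum (F.hasSum_iUnion s hs hd (U h))

theorem map_comap_proj (F : SpectralMeasure K) (U : H ≃ₗᵢ[ℂ] K) (Δ : Set ℝ) (h : H) :
    U ((F.comap U).proj Δ h) = F.proj Δ (U h) :=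
  U.apply_symm_apply _

theorem IsSpectralMeasureOf.comap {B : K →L[ℂ] K} (hF : F.IsSpectralMeasureOf B)
    (U : H ≃ₗᵢ[ℂ] K) {A : H →L[ℂ] H} (hU : ∀ h, U (A h) = B (U h)) :
    (F.comap U).IsSpectralMeasureOf A := by
  obtain ⟨⟨C, hC, hCu, hC1⟩, hB⟩ := hF
  refine ⟨⟨C, hC, hCu, ?_⟩, fun h => ?_⟩
  · ext h
    refine U.injective ?_
    rw [map_comap_proj, hC1]
    rfl
  · rw [← scalarMeasure_map U fun Δ _ => map_comap_proj F U Δ, ← U.inner_map_map, hU]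
    exact hB (U h)

/-- Bounded selfadjoint operators are unitarily equivalent exactly if their spectral measures
are. -/
theorem IsSpectralMeasureOf.unitarilyEquivalent_iff {A : H →L[ℂ] H} {B : K →L[ℂ] K}
    (hE : E.IsSpectralMeasureOf A) (hF : F.IsSpectralMeasureOf B) :
    _root_.UnitarilyEquivalent A B ↔ E.UnitarilyEquivalent F := by
  constructor
  · rintro ⟨U, hU⟩
    refine ⟨U, fun Δ hΔ h => ?_⟩
    rw [hE.proj_eq (hF.comap U hU) hΔ, map_comap_proj]
  · rintro ⟨U, hU⟩
    exact ⟨U, hE.2.map_apply hF.2 U hU⟩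

theorem HasIntegral.congr {φ ψ : ℝ → ℝ} {T : H →L[ℂ] H} (hT : E.HasIntegral φ T) {C : Set ℝ}
    (hC : IsCompact C) (hC1 : E.proj C = 1) (h : EqOn φ ψ C) : E.HasIntegral ψ T := by
  intro x
  have h1 : φ =ᵐ[E.scalarMeasure x] ψ := by
    have h2 : ∀ᵐ t ∂(E.scalarMeasure x), t ∈ C :=
      mem_ae_iff.2 (scalarMeasure_compl_eq_zero hC hC1 hC.measurableSet subset_rfl x)
    filter_upwards [h2] with t ht using h ht
  exact ⟨(hT x).1.congr h1, by rw [(hT x).2, integral_congr_ae h1]⟩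

theorem HasIntegral.norm_sq_le {φ : ℝ → ℝ} {T : H →L[ℂ] H} (hT : E.HasIntegral φ T) {C : Set ℝ}
    (hC : IsCompact C) (hC1 : E.proj C = 1) (h : ∀ t ∈ C, 1 ≤ φ t) (x : H) :
    ‖x‖ ^ 2 ≤ (⟪T x, x⟫_ℂ).re := by
  have h1 : (⟪T x, x⟫_ℂ).re = ∫ t, φ t ∂(E.scalarMeasure x) := by
    have h2 := congrArg Complex.re (hT x).2
    rw [Complex.ofReal_re] at h2
    rw [← h2, ← inner_conj_symm, Complex.conj_re]
  have h3 : ∫ _, (1 : ℝ) ∂(E.scalarMeasure x) ≤ ∫ t, φ t ∂(E.scalarMeasure x) := by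
    refine integral_mono_ae (integrable_const _) (hT x).1 ?_
    have h2 : ∀ᵐ t ∂(E.scalarMeasure x), t ∈ C :=
      mem_ae_iff.2 (scalarMeasure_compl_eq_zero hC hC1 hC.measurableSet subset_rfl x)
    filter_upwards [h2] with t ht using h t ht
  rw [h1]
  refine le_trans (le_of_eq ?_) h3
  rw [integral_const, smul_eq_mul, mul_one, norm_sq_of_scalarMeasure_eq rfl]

theorem HasIntegral.isPositive {φ : ℝ → ℝ} {T : H →L[ℂ] H} (hT : E.HasIntegral φ T) {C : Set ℝ}
    (hC : IsCompact C) (hC1 : E.proj C = 1) (h : ∀ t ∈ C, 1 ≤ φ t) : T.IsPositive :=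
  ⟨hT.isSymmetric, fun x => (sq_nonneg ‖x‖).trans (hT.norm_sq_le hC hC1 h x)⟩

theorem HasIntegral.eq_zero_of_inner_eq_zero {φ : ℝ → ℝ} {T : H →L[ℂ] H}
    (hT : E.HasIntegral φ T) {C : Set ℝ} (hC : IsCompact C) (hC1 : E.proj C = 1)
    (h : ∀ t ∈ C, 1 ≤ φ t) {x : H} (hx : ⟪T x, x⟫_ℂ = 0) : x = 0 := by
  have h1 := hT.norm_sq_le hC hC1 h x
  rw [hx, Complex.zero_re] at h1
  have h2 := le_antisymm h1 (sq_nonneg ‖x‖)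
  simpa using h2

end Operators

-- Unitary invariance of spectral type and multiplicity

section Invariants

variable {H : Type u} [NormedAddCommGroup H] [InnerProductSpace ℂ H] [CompleteSpace H]
variable {K : Type u} [NormedAddCommGroup K] [InnerProductSpace ℂ K] [CompleteSpace K]
variable {E : SpectralMeasure H} {F : SpectralMeasure K}

theorem UnitarilyEquivalent.symm (h : E.UnitarilyEquivalent F) : F.UnitarilyEquivalent E := by
  obtain ⟨U, hU⟩ := h
  refine ⟨U.symm, fun Δ hΔ x => ?_⟩
  rw [U.symm_apply_eq, hU Δ hΔ, U.apply_symm_apply]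

theorem UnitarilyEquivalent.spectralType_subset (h : E.UnitarilyEquivalent F) :
    E.spectralType ⊆ F.spectralType := by
  obtain ⟨U, hU⟩ := h
  rintro μ ⟨hμ, x, hx⟩
  exact ⟨hμ, U x, by rwa [scalarMeasure_map U hU]⟩

theorem UnitarilyEquivalent.multiplicity_le (h : E.UnitarilyEquivalent F) (μ : Measure ℝ) :
    E.multiplicity μ ≤ F.multiplicity μ := by
  obtain ⟨U, hU⟩ := h
  refine ciSup_le' fun s => ?_
  have hs : F.IsMultiplicityFamily μ (U '' s.1) := by
    refine ⟨?_, ?_, ?_⟩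
    · rintro _ ⟨x, hx, rfl⟩
      exact fun h0 => s.2.1 x hx (by simpa using h0)
    · rintro _ ⟨x, hx, rfl⟩
      rw [scalarMeasure_map U hU, s.2.2.1 x hx]
    · rintro _ ⟨x, hx, rfl⟩ _ ⟨y, hy, rfl⟩ hxy Δ hΔ
      rw [← hU Δ hΔ, U.inner_map_map]
      exact s.2.2.2 x hx y hy (fun h => hxy (congrArg U h)) Δ hΔ
  rw [← Cardinal.mk_image_eq U.injective]
  exact le_ciSup (f := fun s : {s : Set K // F.IsMultiplicityFamily μ s} => Cardinal.mk s.1)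
    Cardinal.bddAbove_of_small ⟨_, hs⟩

end Invariants

end SpectralMeasure

-- The functions `xi` and the main theorem

theorem xi_zero_eqOn : EqOn (xi 0) (fun x => x) (Ici 1) := by
  intro x hx
  have hx0 : 0 ≤ x := zero_le_one.trans hx
  have h1 : (1 + (((0 : ℕ) : ℝ) + 1) * (x ^ 2 - 1)) / (1 + ((0 : ℕ) : ℝ) * (x ^ 2 - 1)) = x ^ 2 := by
    simp
  simp only [xi]
  rw [h1, Real.sqrt_sq hx0]

/-- Under the root the numerator exceeds the positive denominator by x² − 1 ≥ 0. This bound makes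
the weights positive and injective. -/
theorem one_le_xi (n : ℕ) {x : ℝ} (hx : x ∈ Ici (1 : ℝ)) : 1 ≤ xi n x := by
  have h1 : 0 ≤ x ^ 2 - 1 := by
    have : (1 : ℝ) ≤ x := hx
    nlinarith
  have h2 : 0 < 1 + (n : ℝ) * (x ^ 2 - 1) := by positivity
  rw [xi, Real.one_le_sqrt, le_div_iff₀ h2]
  linarith

end

theorem theorem3p3 {M M' : Type u}
    [NormedAddCommGroup M] [InnerProductSpace ℂ M] [CompleteSpace M] [Nontrivial M]
    [NormedAddCommGroup M'] [InnerProductSpace ℂ M'] [CompleteSpace M'] [Nontrivial M']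
    (E : SpectralMeasure M) (E' : SpectralMeasure M')
    (hE : E.IsCompactlySupportedIn (Ici 1)) (hE' : E'.IsCompactlySupportedIn (Ici 1))
    (w : ℕ → M →L[ℂ] M) (w' : ℕ → M' →L[ℂ] M')
    (hw : ∀ n, E.HasIntegral (xi n) (w n)) (hw' : ∀ n, E'.HasIntegral (xi n) (w' n))
    (W : EllTwo M →L[ℂ] EllTwo M) (W' : EllTwo M' →L[ℂ] EllTwo M')
    (hW : IsWeightedShift W w) (hW' : IsWeightedShift W' w') :
    List.TFAE
      [UnitarilyEquivalent W W',
        UnitarilyEquivalent (w 0) (w' 0),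
        SameTypeAndMultiplicity (w 0) (w' 0),
        E.UnitarilyEquivalent E'] ∧
    (TopologicalSpace.SeparableSpace M → TopologicalSpace.SeparableSpace M' →
      (∃ (μ : Measure ℝ) (n : ℝ → ℕ∞), IsClassicalTypeAndMultiplicity (w 0) μ n) ∧
      (∃ (μ' : Measure ℝ) (n' : ℝ → ℕ∞), IsClassicalTypeAndMultiplicity (w' 0) μ' n') ∧
      ∀ (μ μ' : Measure ℝ) (n n' : ℝ → ℕ∞),
        IsClassicalTypeAndMultiplicity (w 0) μ n →
        IsClassicalTypeAndMultiplicity (w' 0) μ' n' →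
        (UnitarilyEquivalent (w 0) (w' 0) ↔ μ ≪ μ' ∧ μ' ≪ μ ∧ n =ᵐ[μ] n')) ∧
    (IsDiagonal (w 0) → IsDiagonal (w' 0) →
      (UnitarilyEquivalent (w 0) (w' 0) ↔
        ∀ c : ℂ, hilbertDim (LinearMap.ker (c • (1 : M →L[ℂ] M) - w 0).toLinearMap) =
          hilbertDim (LinearMap.ker (c • (1 : M' →L[ℂ] M') - w' 0).toLinearMap))) := by
  obtain ⟨C, hC, hCs, hC1⟩ := hE
  obtain ⟨C', hC', hCs', hC1'⟩ := hE'
  -- On the support of E the function `xi 0` is the identity, so w 0 is the integral of the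
  -- coordinate.
  have hEw : E.IsSpectralMeasureOf (w 0) :=
    ⟨⟨C, hC, subset_univ C, hC1⟩, (hw 0).congr hC hC1 (xi_zero_eqOn.mono hCs)⟩
  have hEw' : E'.IsSpectralMeasureOf (w' 0) :=
    ⟨⟨C', hC', subset_univ C', hC1'⟩, (hw' 0).congr hC' hC1' (xi_zero_eqOn.mono hCs')⟩
  have hxi : ∀ n, ∀ t ∈ C, 1 ≤ xi n t := fun n t ht => one_le_xi n (hCs ht)
  have hxi' : ∀ n, ∀ t ∈ C', 1 ≤ xi n t := fun n t ht => one_le_xi n (hCs' ht)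
  refine ⟨?_, fun _ _ => ⟨?_, ?_, ?_⟩, fun hd hd' =>
    hd.unitarilyEquivalent_iff hd' (hw 0).isSymmetric (hw' 0).isSymmetric⟩
  · tfae_have 1 → 2 := hW.unitarilyEquivalent_weight_zero hW'
      (fun n _ => (hw n).eq_zero_of_inner_eq_zero hC hC1 (hxi n))
      (fun n _ => (hw' n).eq_zero_of_inner_eq_zero hC' hC1' (hxi' n))
      ((hw 0).isPositive hC hC1 (hxi 0)) ((hw' 0).isPositive hC' hC1' (hxi' 0))
    tfae_have 2 ↔ 4 := hEw.unitarilyEquivalent_iff hEw'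
    tfae_have 4 → 1 := fun ⟨U, hU⟩ =>
      hW.unitarilyEquivalent hW' U fun n => (hw n).map_apply (hw' n) U hU
    tfae_have 4 → 3 := fun h => ⟨E, E', hEw, hEw',
      h.spectralType_subset.antisymm h.symm.spectralType_subset,
      fun μ _ => (h.multiplicity_le μ).antisymm (h.symm.multiplicity_le μ)⟩
    tfae_have 3 → 2 := fun ⟨F, F', hF, hF', _, hm⟩ =>
      (hF.unitarilyEquivalent_iff hF').2 (SpectralMeasure.UnitarilyEquivalent.of_multiplicity_eq hm)
    tfae_finish
  · obtain ⟨μ, n, h⟩ := SpectralMeasure.exists_isClassicalTypeAndMultiplicity E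
    exact ⟨μ, n, E, hEw, h⟩
  · obtain ⟨μ, n, h⟩ := SpectralMeasure.exists_isClassicalTypeAndMultiplicity E'
    exact ⟨μ, n, E', hEw', h⟩
  · rintro μ μ' n n' ⟨F, hF, h⟩ ⟨F', hF', h'⟩
    rw [hF.unitarilyEquivalent_iff hF']
    exact h.unitarilyEquivalent_iff h'
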